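/- A \emph{weight matrix} is a $2\times 2$ matrix $W$ of complex Borel measures on $\mathbb{R}$ such that $W(\Omega)$ is Hermitian positive semidefinite for every Borel set $\Omega$, all moments $\int t^n\,dW(t)$, $n\ge 0$, exist and are finite, and $\int P\,dW\,P^*$ is nonsingular for every matrix polynomial $P$ (with coefficients in $\mathbb{C}^{2\times 2}$) whose leading coefficient is nonsingular. For $D=\partial^2F_2(t)+\partial^1F_1(t)+\partial^0F_0$ with matrix polynomial coefficients put $PD=P''F_2+P'F_1+PF_0$; $D$ is \emph{symmetric} with respect to $W$ if $\int (PD)\,dW\,Q^*=\int P\,dW\,(QD)^*$ for all matrix polynomials $P,Q$, and $\Upsilon(D)$ is the set of all weight matrices with respect to which $D$ is symmetric. Let $a\in\mathbb{R}\setminus\{0\}$, $\alpha>-1$, $t_0\in\mathbb{R}$, let $B=\begin{pmatrix}1&a\\0&0\end{pmatrix}$ and $$W_{a,\alpha}(t)=t^{\alpha}e^{-t}\,t^{B}t^{B^*},\qquad t>0,\qquad t^B=e^{(\log t)B}.$$ Fix one of the two signs $\pm$ and let $$\phi=\phi^{\pm}=\frac{(a^2+1)(t_0+\alpha)-a^2+1\pm\sqrt{(a^2+1)\left(a^2(t_0-\alpha-1)^2+(t_0+\alpha+1)^2\right)}}{2a},\qquad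 M=M(a,\alpha,t_0)=\begin{pmatrix}\phi^2&\phi\\ \phi&1\end{pmatrix}.$$ Let $D_{a,\alpha,t_0}=\partial^2F_2(t)+\partial^1F_1(t)+\partial^0F_0$, where $$F_2(t)=\begin{pmatrix}at_0&a^2t_0\\-t_0&-at_0\end{pmatrix}+t\begin{pmatrix}\phi-\frac{1+(\alpha+t_0)(1+a^2)}{a}&-(\alpha+t_0+1)(1+a^2)\\0&\phi+a\end{pmatrix}+t^2\begin{pmatrix}0&(1+a^2)(1+\alpha)\\0&0\end{pmatrix},$$ $F_1(t)=G_0+tG_1$ with $$(G_0)_{11}=-a\left(3t_0-2+(\alpha+1)^2\right)+(\alpha+3)\left(\phi-\tfrac{t_0+\alpha+1}{a}\right),$$ $$(G_0)_{12}=2a\phi-(1+a^2)(\alpha^2+2t_0+3\alpha)+\alpha t_0(a^2-1)-(t_0+\alpha+3),$$ $$(G_0)_{21}=t_0-\alpha-1,\qquad (G_0)_{22}=\phi(\alpha+1)-a\alpha t_0,$$ $$G_1=\begin{pmatrix}-\phi+a(t_0-1)+\frac{t_0+\alpha+1}{a}&(1+a^2)(\alpha^2+3\alpha-t_0\alpha+2)+2(\alpha+1)\\0&-\phi+a\alpha\end{pmatrix},$$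 and $$F_0=\begin{pmatrix}d&1+a\alpha\phi-\alpha(t_0-1)(a^2+\alpha+2)+\frac{1+\alpha}{1+a^2}\\ \frac{1+\alpha}{1+a^2}&-d\end{pmatrix},\qquad d=-\frac{\phi}{2}+\frac{a(t_0-1)}{2}+\frac{(\alpha+2)(t_0+\alpha+1)}{2a}-\frac{a(1+\alpha)}{1+a^2}.$$ Then $M$ is Hermitian positive semidefinite, $F_2(t_0)M=F_1(t_0)M=0$ and $F_0M=MF_0^*$; the operator $D_{a,\alpha,t_0}$ is symmetric with respect to $\gamma W_{a,\alpha}\chi_{(0,\infty)}\,dt+\zeta\,\delta_{t_0}M$ for all $\gamma>0$, $\zeta\ge 0$; and these are all the weight matrices for which it is symmetric: $$\Upsilon(D_{a,\alpha,t_0})=\{\gamma W_{a,\alpha}\chi_{(0,\infty)}\,dt+\zeta\,\delta_{t_0}M:\ \gamma>0,\ \zeta\ge 0\}.$$ -/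

import Mathlib

open MeasureTheory Polynomial
open scoped Matrix ComplexOrder

noncomputable section

namespace MatrixOrthogonality

/-- A square matrix of (finite, complex) Borel measures on the real line. -/
abbrev MatrixMeasure (n : Type*) : Type _ := Matrix n n (ComplexMeasure ℝ)

/-- A matrix polynomial, i.e. a polynomial in one (central) variable with coefficients in
the complex `n × n` matrices. -/
abbrev MatrixPolynomial (n : Type*) [Fintype n] [DecidableEq n] : Type _ := (Matrix n n ℂ)[X]

section General

variable {n : Type*} [Fintype n] [DecidableEq n]

/-- The numerical matrix `P(t)`, for a matrix polynomial `P` and a real number `t`. -/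
def evalAt (P : MatrixPolynomial n) (t : ℝ) : Matrix n n ℂ :=
  P.eval (Matrix.scalar n (t : ℂ))

/-- The numerical matrix `W(Ω)`. -/
def setValue (W : MatrixMeasure n) (s : Set ℝ) : Matrix n n ℂ :=
  Matrix.of fun i j => W i j s

/-- The matrix valued form `⟨P, Q⟩ = ∫ P(t) dW(t) Q(t)^*`: its `(i, j)` entry is
`∑ k, ∑ l, ∫ P(t)_{ik} * conj (Q(t)_{jl}) dW_{kl}(t)`. -/
def pairing (W : MatrixMeasure n) (P Q : MatrixPolynomial n) : Matrix n n ℂ :=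
  Matrix.of fun i j => ∑ k, ∑ l,
    (W k l).integral (fun t : ℝ => evalAt P t i k * star (evalAt Q t j l))
      (ContinuousLinearMap.mul ℝ ℂ)

/-- Weight matrices: `W(Ω)` is positive semidefinite for all Borel sets `Ω`, all moments
exist, and `∫ P dW P^*` is nonsingular as soon as the leading coefficient of `P` is. -/
structure IsWeightMatrix (W : MatrixMeasure n) : Prop where
  posSemidef : ∀ s : Set ℝ, MeasurableSet s → (setValue W s).PosSemidef
  moments : ∀ (k : ℕ) (i j : n), (W i j).Integrable (fun t : ℝ => t ^ k)
  nonsingular : ∀ P : MatrixPolynomial n, IsUnit P.leadingCoeff → IsUnit (pairing W P P)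

/-- The coefficients of a right-hand side differential operator
`∂² F₂(t) + ∂¹ F₁(t) + ∂⁰ F₀(t)`. -/
structure SecondOrderOperator (n : Type*) [Fintype n] [DecidableEq n] where
  F₂ : MatrixPolynomial n
  F₁ : MatrixPolynomial n
  F₀ : MatrixPolynomial n

/-- The action `P D = P'' F₂ + P' F₁ + P F₀` on matrix polynomials. -/
def SecondOrderOperator.act (D : SecondOrderOperator n) (P : MatrixPolynomial n) :
    MatrixPolynomial n :=
  derivative (derivative P) * D.F₂ + derivative P * D.F₁ + P * D.F₀

/-- `D` is symmetric with respect to `W`: `⟨PD, Q⟩ = ⟨P, QD⟩` for all matrix polynomials. -/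
def SecondOrderOperator.IsSymmetric (D : SecondOrderOperator n) (W : MatrixMeasure n) : Prop :=
  ∀ P Q : MatrixPolynomial n, pairing W (D.act P) Q = pairing W P (D.act Q)

/-- The set `Υ(D)` of all weight matrices with respect to which `D` is symmetric. -/
def Upsilon (D : SecondOrderOperator n) : Set (MatrixMeasure n) :=
  {W | IsWeightMatrix W ∧ D.IsSymmetric W}

/-- The matrix measure `δ_{t₀} M`. -/
def pointMass (t₀ : ℝ) (M : Matrix n n ℂ) : MatrixMeasure n :=
  Matrix.of fun i j => VectorMeasure.dirac t₀ (M i j)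

/-- The power `t^A = exp ((log t) A)` of a positive number `t` with a matrix exponent. -/
def matPow (t : ℝ) (A : Matrix n n ℂ) : Matrix n n ℂ :=
  NormedSpace.exp ((Real.log t : ℂ) • A)

end General

/-- A real matrix, seen as a complex matrix. -/
def toC (A : Matrix (Fin 2) (Fin 2) ℝ) : Matrix (Fin 2) (Fin 2) ℂ :=
  A.map Complex.ofReal

/-- The matrix `B`. -/
def laguerreB (a : ℝ) : Matrix (Fin 2) (Fin 2) ℂ :=
  toC !![1, a;
         0, 0]

/-- The density `t^α e^{-t} t^B t^{B^*}`, for `t > 0`. -/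
def laguerreDensity (a α t : ℝ) : Matrix (Fin 2) (Fin 2) ℂ :=
  ((t ^ α * Real.exp (-t) : ℝ) : ℂ) •
    (matPow t (laguerreB a) * matPow t (laguerreB a)ᴴ)

/-- The matrix measure `W_{a,α}(t) χ_{(0,∞)}(t) dt`. -/
def laguerreWeight (a α : ℝ) : MatrixMeasure (Fin 2) :=
  Matrix.of fun i j =>
    (volume.restrict (Set.Ioi (0 : ℝ))).withDensityᵥ fun t => laguerreDensity a α t i j

/-- The number `φ^±`; the unit `ε = ±1` is the chosen sign of the square root. -/
def phi (ε : ℤˣ) (a α t₀ : ℝ) : ℝ :=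
  ((a ^ 2 + 1) * (t₀ + α) - a ^ 2 + 1 +
      ((ε : ℤ) : ℝ) *
        √((a ^ 2 + 1) * (a ^ 2 * (t₀ - α - 1) ^ 2 + (t₀ + α + 1) ^ 2))) / (2 * a)

/-- The mass `M(a, α, t₀)`. -/
def mass (ε : ℤˣ) (a α t₀ : ℝ) : Matrix (Fin 2) (Fin 2) ℂ :=
  toC !![phi ε a α t₀ ^ 2, phi ε a α t₀; phi ε a α t₀, 1]

/-- The coefficient `F₂(t)` of `D_{a,α,t₀}`. -/
def laguerreF₂ (ε : ℤˣ) (a α t₀ : ℝ) : MatrixPolynomial (Fin 2) :=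
  C (toC !![a * t₀, a ^ 2 * t₀;
            -t₀, -(a * t₀)]) +
  X * C (toC !![phi ε a α t₀ - (1 + (α + t₀) * (1 + a ^ 2)) / a, -((α + t₀ + 1) * (1 + a ^ 2));
                0, phi ε a α t₀ + a]) +
  X ^ 2 * C (toC !![0, (1 + a ^ 2) * (1 + α);
                    0, 0])

/-- The coefficient `F₁(t)` of `D_{a,α,t₀}`. -/
def laguerreF₁ (ε : ℤˣ) (a α t₀ : ℝ) : MatrixPolynomial (Fin 2) :=
  C (toC !![-(a * (3 * t₀ - 2 + (α + 1) ^ 2)) + (α + 3) * (phi ε a α t₀ - (t₀ + α + 1) / a),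
              (2 * a * phi ε a α t₀ - (1 + a ^ 2) * (α ^ 2 + 2 * t₀ + 3 * α))
                + α * t₀ * (a ^ 2 - 1) - (t₀ + α + 3);
            t₀ - α - 1,
              phi ε a α t₀ * (α + 1) - a * α * t₀]) +
  X * C (toC !![-phi ε a α t₀ + a * (t₀ - 1) + (t₀ + α + 1) / a,
                  (1 + a ^ 2) * (α ^ 2 + 3 * α - t₀ * α + 2) + 2 * (α + 1);
                0,
                  -phi ε a α t₀ + a * α])

/-- The upper left entry of `F₀`. -/
def laguerreF₀Diag (ε : ℤˣ) (a α t₀ : ℝ) : ℝ :=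
  -(phi ε a α t₀ / 2) + a * (t₀ - 1) / 2 + (α + 2) * (t₀ + α + 1) / (2 * a)
    - a * (1 + α) / (1 + a ^ 2)

/-- The constant coefficient `F₀` of `D_{a,α,t₀}`. -/
def laguerreF₀ (ε : ℤˣ) (a α t₀ : ℝ) : Matrix (Fin 2) (Fin 2) ℂ :=
  toC !![laguerreF₀Diag ε a α t₀,
           1 + a * α * phi ε a α t₀ - α * (t₀ - 1) * (a ^ 2 + α + 2) + (1 + α) / (1 + a ^ 2);
         (1 + α) / (1 + a ^ 2),
           -laguerreF₀Diag ε a α t₀]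

/-- The operator `D_{a,α,t₀} = ∂² F₂(t) + ∂¹ F₁(t) + ∂⁰ F₀`. -/
def laguerreOperator (ε : ℤˣ) (a α t₀ : ℝ) : SecondOrderOperator (Fin 2) where
  F₂ := laguerreF₂ ε a α t₀
  F₁ := laguerreF₁ ε a α t₀
  F₀ := C (laguerreF₀ ε a α t₀)

end MatrixOrthogonality

end

/-! Symmetry of an operator with polynomial coefficients depends on a weight only through its
moments. Tested on monomials, it becomes linear equations for the moment sequence
(`isSymmetric_iff_momentEquations`), and the theorem amounts to solving them among Hermitian
sequences and then returning from moments to measures.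

Both generators are solutions. For the Laguerre weight, the scalar moments satisfy `g (k + 1) = (α +
1 + k) * g k`, and the equations become polynomial identities (`momentEquations_laguerreMoment`).
For the point mass, the terms with `F₂` and `F₁` die on `M`, and `F₀ M` is Hermitian
(`isSymmetric_pointMass`). Both facts rest on the quadratic equation for `φ` in `phi_relation`.

There are no others. Write `s = t₀`, `p = φ`, `r = (t₀ + α + 1) / a`, `q = p - a * (s - 1)`. The
density is `T(t) diag(t ^ 2, 1) T(t)^*` times `t ^ α e ^ (-t)`, with `T(t)` unipotent of
off-diagonal entry `a * (t - 1)`. Removing `T` from the moments diagonalises the Laguerre part and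
turns the mass vector `(p, 1)` into `(q, 1)`. The reduced equations force a geometric off-diagonal
sequence of ratio `s`; subtracting the corresponding point mass leaves the Gamma recursion
(`exists_laguerre_moments`, `exists_moment_eq`).

The Laguerre weight and the point mass have exponential moments, so positive measures with such
moments are determinate (`ext_of_integral_pow_eq`, `ext_of_moment_eq`). The two real coefficients
found have no sign a priori. `eq_combination_of_moment_eq` moves negative parts across the equation,
applies determinacy, and then reads the signs off `{t₀}` and its complement; nonsingularity excludes
a pure point mass. -/

noncomputable section

namespace MatrixOrthogonality

/-! ### Integration against complex measures with a density -/

section VectorIntegral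

variable {X : Type*} [MeasurableSpace X]

theorem integrable_variation_withDensityᵥ_iff {ν : Measure X} {h : X → ℂ} (hh : Integrable h ν)
    {E : Type*} [NormedAddCommGroup E] [NormedSpace ℝ E] {f : X → E} :
    (ν.withDensityᵥ h).Integrable f ↔ Integrable (fun x => ‖h x‖ • f x) ν := by
  rw [VectorMeasure.Integrable, Measure.variation_withDensityᵥ hh,
    integrable_withDensity_iff_integrable_smul₀' hh.1.enorm
      (Filter.Eventually.of_forall fun x => by simp)]
  simp

theorem integrable_mul_of_integrable_norm_smul {ν : Measure X} {h : X → ℂ}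
    (hh : AEStronglyMeasurable h ν) {f : X → ℂ} (hf : Integrable (fun x => ‖h x‖ • f x) ν) :
    Integrable (fun x => f x * h x) ν := by
  have hm : AEStronglyMeasurable (fun x => f x * h x) ν := by
    -- Only `‖h‖ • f` is known to be measurable, since `f` is arbitrary where `h` vanishes; hence
    -- the factorisation through the phase of `h`.
    have : (fun x => f x * h x) = fun x => (‖h x‖ • f x) * ((‖h x‖ : ℂ)⁻¹ * h x) := by
      funext x
      by_cases hx : h x = 0
      · simp [hx]
      · have : (‖h x‖ : ℂ) ≠ 0 := by simpa using hx
        rw [Complex.real_smul]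
        field_simp
    rw [this]
    refine hf.1.mul (AEStronglyMeasurable.mul ?_ hh)
    exact (Complex.measurable_ofReal.comp_aemeasurable hh.norm.aemeasurable).inv.aestronglyMeasurable
  exact hf.mono hm (Filter.Eventually.of_forall fun x => by simp [mul_comm])

/-- The variation has density `‖h‖`, so both sides are continuous in `f` for the `L¹` norm of the
variation, and it suffices to compare them on indicator functions. -/
theorem integral_withDensityᵥ_mul {ν : Measure X} {h : X → ℂ} (hh : Integrable h ν) {f : X → ℂ}
    (hf : (ν.withDensityᵥ h).Integrable f) :
    (ν.withDensityᵥ h).integral f (ContinuousLinearMap.mul ℝ ℂ) = ∫ x, f x * h x ∂ν := by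
  have hint : ∀ {g : X → ℂ}, (ν.withDensityᵥ h).Integrable g → Integrable (fun x => g x * h x) ν :=
    fun hg => integrable_mul_of_integrable_norm_smul hh.1
      ((integrable_variation_withDensityᵥ_iff hh).1 hg)
  refine Integrable.induction (μ := (ν.withDensityᵥ h).variation)
    (fun f => (ν.withDensityᵥ h).integral f (ContinuousLinearMap.mul ℝ ℂ) = ∫ x, f x * h x ∂ν)
    ?_ ?_ ?_ ?_ hf
  · intro c s hs hsf
    rw [VectorMeasure.integral_eq_setToFun, setToFun_indicator_const _ hs hsf.ne]
    have : (fun x => s.indicator (fun _ => c) x * h x) = s.indicator (fun x => c * h x) := by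
      funext x
      by_cases hx : x ∈ s <;> simp [hx]
    rw [this, integral_indicator hs, integral_const_mul, ← withDensityᵥ_apply hh hs]
    rfl
  · intro f g _ hf hg h1 h2
    rw [VectorMeasure.integral_add hf hg, h1, h2, ← integral_add (hint hf) (hint hg)]
    simp [add_mul]
  · refine isClosed_eq VectorMeasure.continuous_integral ?_
    refine LipschitzWith.continuous (K := 1) (LipschitzWith.of_dist_le_mul fun f g => ?_)
    have hf := L1.integrable_coeFn f
    have hg := L1.integrable_coeFn g
    have key : ∀ u : X → ℝ, ∫ x, u x ∂(ν.withDensityᵥ h).variation = ∫ x, ‖h x‖ • u x ∂ν := by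
      intro u
      rw [Measure.variation_withDensityᵥ hh, integral_withDensity_eq_integral_toReal_smul₀
        hh.1.enorm (Filter.Eventually.of_forall fun x => by simp)]
      simp
    rw [dist_eq_norm, ← integral_sub (hint hf) (hint hg), NNReal.coe_one, one_mul, dist_eq_norm,
      L1.norm_eq_integral_norm, integral_congr_ae ((Lp.coeFn_sub f g).mono fun x hx => by
        rw [hx, Pi.sub_apply]), key]
    refine (norm_integral_le_integral_norm _).trans_eq (integral_congr_ae ?_)
    filter_upwards with x
    rw [← sub_mul, norm_mul, mul_comm, smul_eq_mul]
  · intro f g hfg hf h1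
    rw [← VectorMeasure.integral_congr_ae hfg, h1]
    have := (Measure.variation_withDensityᵥ hh) ▸ hfg
    rw [Filter.EventuallyEq, ae_withDensity_iff' hh.1.enorm] at this
    refine integral_congr_ae ?_
    filter_upwards [this] with x hx
    by_cases h0 : h x = 0
    · simp [h0]
    · rw [hx (by simpa using h0)]

/-- A complex measure of finite variation has a density with respect to any finite measure
dominating its variation. -/
theorem exists_integrable_withDensityᵥ_eq {c : ComplexMeasure X} {τ : Measure X}
    [IsFiniteMeasure τ] (hc : c.variation ≪ τ) :
    ∃ h : X → ℂ, Integrable h τ ∧ τ.withDensityᵥ h = c := by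
  have hac : ∀ s, MeasurableSet s → τ s = 0 → c s = 0 := fun s hs h0 => by
    have := VectorMeasure.enorm_measure_le_variation c s
    rw [hc h0] at this
    simpa using this
  have hre : τ.withDensityᵥ ((ComplexMeasure.re c).rnDeriv τ) = ComplexMeasure.re c :=
    SignedMeasure.withDensityᵥ_rnDeriv_eq _ _ (VectorMeasure.AbsolutelyContinuous.mk
      fun s hs h0 => by
        rw [Measure.toENNRealVectorMeasure_apply_measurable hs] at h0
        change (c s).re = 0
        simp [hac s hs h0])
  have him : τ.withDensityᵥ ((ComplexMeasure.im c).rnDeriv τ) = ComplexMeasure.im c :=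
    SignedMeasure.withDensityᵥ_rnDeriv_eq _ _ (VectorMeasure.AbsolutelyContinuous.mk
      fun s hs h0 => by
        rw [Measure.toENNRealVectorMeasure_apply_measurable hs] at h0
        change (c s).im = 0
        simp [hac s hs h0])
  have hir := SignedMeasure.integrable_rnDeriv (ComplexMeasure.re c) τ
  have hii := SignedMeasure.integrable_rnDeriv (ComplexMeasure.im c) τ
  refine ⟨fun x => ((ComplexMeasure.re c).rnDeriv τ x : ℂ) +
    ((ComplexMeasure.im c).rnDeriv τ x : ℂ) * Complex.I, hir.ofReal.add (hii.ofReal.mul_const _), ?_⟩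
  ext s hs
  rw [withDensityᵥ_apply (hir.ofReal.add (hii.ofReal.mul_const _)) hs,
    integral_add (hir.ofReal.restrict (s := s)) ((hii.ofReal.mul_const _).restrict (s := s)),
    integral_mul_const, integral_complex_ofReal, integral_complex_ofReal, ← withDensityᵥ_apply hir hs,
    ← withDensityᵥ_apply hii hs, hre, him]
  exact Complex.re_add_im (c s)

end VectorIntegral

/-! ### Matrix polynomials, the pairing and its moments -/

section Moments

set_option linter.unusedSectionVars false

variable {n : Type*} [Fintype n] [DecidableEq n]

theorem evalAt_apply (P : MatrixPolynomial n) (t : ℝ) (i j : n) :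
    evalAt P t i j = (matPolyEquiv.symm P i j).eval (t : ℂ) := by
  rw [← matPolyEquiv_eval, AlgEquiv.apply_symm_apply]
  rfl

theorem evalAt_eq_map (P : MatrixPolynomial n) (t : ℝ) :
    evalAt P t = (matPolyEquiv.symm P).map (evalRingHom (t : ℂ)) := by
  ext i j
  simp [evalAt_apply]

theorem evalAt_add (P Q : MatrixPolynomial n) (t : ℝ) :
    evalAt (P + Q) t = evalAt P t + evalAt Q t := eval_add

theorem evalAt_mul (P Q : MatrixPolynomial n) (t : ℝ) :
    evalAt (P * Q) t = evalAt P t * evalAt Q t := by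
  simp only [evalAt_eq_map, map_mul, Matrix.map_mul]

theorem evalAt_C (A : Matrix n n ℂ) (t : ℝ) : evalAt (C A) t = A := eval_C

theorem evalAt_X_pow (m : ℕ) (t : ℝ) :
    evalAt (X ^ m : MatrixPolynomial n) t = Matrix.scalar n ((t : ℂ) ^ m) := by
  rw [evalAt, X_pow_eq_monomial, eval_monomial, one_mul, map_pow]

/-- All entries of `W` have moments of all orders. -/
def HasMoments (W : MatrixMeasure n) : Prop :=
  ∀ (k : ℕ) (i j : n), (W i j).Integrable (fun t : ℝ => t ^ k)

/-- The moment `∫ t ^ k dW(t)`. -/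
def moment (W : MatrixMeasure n) (k : ℕ) : Matrix n n ℂ :=
  Matrix.of fun i j => (W i j).integral (fun t : ℝ => (t : ℂ) ^ k) (ContinuousLinearMap.mul ℝ ℂ)

/-- The integral is built from a real bilinear map, so homogeneity for complex scalars needs its own
argument. -/
theorem integral_const_mul_mul {μ : ComplexMeasure ℝ} (c : ℂ) (f : ℝ → ℂ) :
    μ.integral (fun t => c * f t) (ContinuousLinearMap.mul ℝ ℂ) =
      c * μ.integral f (ContinuousLinearMap.mul ℝ ℂ) := by
  simp only [VectorMeasure.integral_eq_setToFun]
  refine setToFun_smul _ (fun c s x => ?_) c f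
  simp [VectorMeasure.transpose, mul_left_comm]

theorem HasMoments.integrable_eval {W : MatrixMeasure n} (hW : HasMoments W) (p : ℂ[X]) (i j : n) :
    (W i j).Integrable (fun t : ℝ => p.eval (t : ℂ)) := by
  induction p using Polynomial.induction_on' with
  | add p q hp hq => simpa using! hp.add hq
  | monomial k c =>
    simpa using ((hW k i j).ofReal (𝕜 := ℂ)).const_mul c

theorem star_eval_ofReal (p : ℂ[X]) (t : ℝ) :
    star (p.eval (t : ℂ)) = (p.map (starRingEnd ℂ)).eval (t : ℂ) := by
  rw [eval_map, eval₂_eq_sum_range, eval_eq_sum_range, star_sum]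
  simp

theorem HasMoments.integrable_evalAt_mul {W : MatrixMeasure n} (hW : HasMoments W)
    (P Q : MatrixPolynomial n) (i j k l r s : n) :
    (W i j).Integrable (fun t : ℝ => evalAt P t k l * star (evalAt Q t r s)) := by
  simp only [evalAt_apply, star_eval_ofReal, ← eval_mul]
  exact hW.integrable_eval _ i j

theorem HasMoments.add {W V : MatrixMeasure n} (hW : HasMoments W) (hV : HasMoments V) :
    HasMoments (W + V) := fun k i j => (hW k i j).add_vectorMeasure (hV k i j)

theorem HasMoments.smul {W : MatrixMeasure n} (hW : HasMoments W) (c : ℝ) :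
    HasMoments (c • W) := fun k i j => (hW k i j).smul_vectorMeasure c

theorem pairing_add_measure {W V : MatrixMeasure n} (hW : HasMoments W) (hV : HasMoments V)
    (P Q : MatrixPolynomial n) : pairing (W + V) P Q = pairing W P Q + pairing V P Q := by
  ext i j
  simp only [pairing, Matrix.of_apply, Matrix.add_apply, ← Finset.sum_add_distrib]
  refine Finset.sum_congr rfl fun k _ => Finset.sum_congr rfl fun l _ => ?_
  exact VectorMeasure.integral_add_vectorMeasure (hW.integrable_evalAt_mul P Q k l i k j l)
    (hV.integrable_evalAt_mul P Q k l i k j l)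

theorem pairing_smul_measure (W : MatrixMeasure n) (c : ℝ) (P Q : MatrixPolynomial n) :
    pairing (c • W) P Q = c • pairing W P Q := by
  ext i j
  simp only [pairing, Matrix.of_apply, Matrix.smul_apply, Finset.smul_sum,
    VectorMeasure.integral_smul_vectorMeasure]

theorem moment_add {W V : MatrixMeasure n} (hW : HasMoments W) (hV : HasMoments V) (k : ℕ) :
    moment (W + V) k = moment W k + moment V k := by
  ext i j
  have := VectorMeasure.integral_add_vectorMeasure (B := ContinuousLinearMap.mul ℝ ℂ)
    (hW.integrable_eval (X ^ k) i j) (hV.integrable_eval (X ^ k) i j)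
  simpa [moment] using this

theorem moment_smul (W : MatrixMeasure n) (c : ℝ) (k : ℕ) : moment (c • W) k = c • moment W k := by
  ext i j
  simp [moment]

theorem pairing_add_left {W : MatrixMeasure n} (hW : HasMoments W) (P P' Q : MatrixPolynomial n) :
    pairing W (P + P') Q = pairing W P Q + pairing W P' Q := by
  ext i j
  simp only [pairing, Matrix.of_apply, Matrix.add_apply, ← Finset.sum_add_distrib, evalAt_add,
    add_mul]
  refine Finset.sum_congr rfl fun k _ => Finset.sum_congr rfl fun l _ => ?_
  exact VectorMeasure.integral_fun_add (hW.integrable_evalAt_mul P Q k l i k j l)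
    (hW.integrable_evalAt_mul P' Q k l i k j l)

theorem pairing_add_right {W : MatrixMeasure n} (hW : HasMoments W) (P Q Q' : MatrixPolynomial n) :
    pairing W P (Q + Q') = pairing W P Q + pairing W P Q' := by
  ext i j
  simp only [pairing, Matrix.of_apply, Matrix.add_apply, ← Finset.sum_add_distrib, evalAt_add,
    star_add, mul_add]
  refine Finset.sum_congr rfl fun k _ => Finset.sum_congr rfl fun l _ => ?_
  exact VectorMeasure.integral_fun_add (hW.integrable_evalAt_mul P Q k l i k j l)
    (hW.integrable_evalAt_mul P Q' k l i k j l)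

theorem pairing_C_mul_left {W : MatrixMeasure n} (hW : HasMoments W) (A : Matrix n n ℂ)
    (P Q : MatrixPolynomial n) : pairing W (C A * P) Q = A * pairing W P Q := by
  ext i j
  simp only [pairing, Matrix.of_apply, Matrix.mul_apply, evalAt_mul, evalAt_C, Finset.sum_mul,
    mul_assoc]
  have : ∀ k l, (W k l).integral (fun t => ∑ r, A i r * (evalAt P t r k * star (evalAt Q t j l)))
      (ContinuousLinearMap.mul ℝ ℂ) = ∑ r, A i r * (W k l).integral
        (fun t => evalAt P t r k * star (evalAt Q t j l)) (ContinuousLinearMap.mul ℝ ℂ) := by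
    intro k l
    rw [VectorMeasure.integral_finsetSum _ fun r _ =>
      (hW.integrable_evalAt_mul P Q k l r k j l).const_mul (A i r)]
    simp only [integral_const_mul_mul]
  simp only [this, Finset.mul_sum]
  exact (Finset.sum_congr rfl fun k _ => Finset.sum_comm).trans Finset.sum_comm

theorem pairing_C_mul_right {W : MatrixMeasure n} (hW : HasMoments W) (A : Matrix n n ℂ)
    (P Q : MatrixPolynomial n) : pairing W P (C A * Q) = pairing W P Q * Aᴴ := by
  ext i j
  simp only [pairing, Matrix.of_apply, Matrix.mul_apply, evalAt_mul, evalAt_C, Finset.mul_sum,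
    star_sum, Matrix.conjTranspose_apply, star_mul']
  have : ∀ k l, (W k l).integral (fun t => ∑ r, evalAt P t i k * (star (A j r) * star (evalAt Q t r l)))
      (ContinuousLinearMap.mul ℝ ℂ) = ∑ r, star (A j r) * (W k l).integral
        (fun t => evalAt P t i k * star (evalAt Q t r l)) (ContinuousLinearMap.mul ℝ ℂ) := by
    intro k l
    simp only [mul_left_comm (evalAt P _ i k)]
    rw [VectorMeasure.integral_finsetSum _ fun r _ =>
      (hW.integrable_evalAt_mul P Q k l i k r l).const_mul (star (A j r))]
    simp only [integral_const_mul_mul]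
  simp only [this, Finset.sum_mul]
  simp only [mul_comm _ (star (A j _))]
  exact (Finset.sum_congr rfl fun k _ => Finset.sum_comm).trans Finset.sum_comm

theorem pairing_X_pow (W : MatrixMeasure n) (m k : ℕ) :
    pairing W (X ^ m) (X ^ k) = moment W (m + k) := by
  ext i j
  simp only [pairing, moment, Matrix.of_apply, evalAt_X_pow, Matrix.scalar_apply,
    Matrix.diagonal_apply]
  rw [Finset.sum_eq_single i, Finset.sum_eq_single j]
  · simp [pow_add]
  · intro l _ hl
    simp [hl.symm]
  · simp
  · intro k _ hk
    simp [hk.symm]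
  · simp

end Moments

/-! ### Symmetry as equations on moments -/

section MomentEquations

set_option linter.unusedSectionVars false

variable {n : Type*} [Fintype n] [DecidableEq n]

theorem SecondOrderOperator.act_add (D : SecondOrderOperator n) (P Q : MatrixPolynomial n) :
    D.act (P + Q) = D.act P + D.act Q := by
  simp only [act, derivative_add, add_mul]
  abel

theorem SecondOrderOperator.act_C_mul (D : SecondOrderOperator n) (A : Matrix n n ℂ)
    (P : MatrixPolynomial n) : D.act (C A * P) = C A * D.act P := by
  simp only [act, derivative_C_mul, mul_add, mul_assoc]

/-- The operator acts from the right, hence commutes with left multiplication by constant matrices,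
and such constants also leave the pairing on either side. -/
theorem isSymmetric_iff_X_pow {D : SecondOrderOperator n} {W : MatrixMeasure n}
    (hW : HasMoments W) :
    D.IsSymmetric W ↔ ∀ m k : ℕ,
      pairing W (D.act (X ^ m)) (X ^ k) = pairing W (X ^ m) (D.act (X ^ k)) := by
  refine ⟨fun h m k => h _ _, fun h P Q => ?_⟩
  induction P using Polynomial.induction_on' with
  | add P P' hP hP' => rw [D.act_add, pairing_add_left hW, pairing_add_left hW, hP, hP']
  | monomial m A =>
    rw [← C_mul_X_pow_eq_monomial, D.act_C_mul, pairing_C_mul_left hW, pairing_C_mul_left hW]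
    congr 1
    induction Q using Polynomial.induction_on' with
    | add Q Q' hQ hQ' => rw [D.act_add, pairing_add_right hW, pairing_add_right hW, hQ, hQ']
    | monomial k B =>
      rw [← C_mul_X_pow_eq_monomial, D.act_C_mul, pairing_C_mul_right hW,
        pairing_C_mul_right hW, h]

/-- The action of `A₀ + t A₁ + t² A₂` on a moment sequence. -/
def quadMoment (A₀ A₁ A₂ : Matrix n n ℂ) (U : ℕ → Matrix n n ℂ) (k : ℕ) : Matrix n n ℂ :=
  A₀ * U k + A₁ * U (k + 1) + A₂ * U (k + 2)

/-- The action of `G₀ + t G₁` on a moment sequence. -/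
def linMoment (G₀ G₁ : Matrix n n ℂ) (U : ℕ → Matrix n n ℂ) (k : ℕ) : Matrix n n ℂ :=
  G₀ * U k + G₁ * U (k + 1)

/-- The moment form of the symmetry equations of the operator
`∂² (A₀ + t A₁ + t² A₂) + ∂¹ (G₀ + t G₁) + ∂⁰ H`. -/
structure MomentEquations (A₀ A₁ A₂ G₀ G₁ H : Matrix n n ℂ) (U : ℕ → Matrix n n ℂ) : Prop where
  quad : ∀ k, (quadMoment A₀ A₁ A₂ U k)ᴴ = quadMoment A₀ A₁ A₂ U k
  lin : ∀ k, linMoment G₀ G₁ U k + (linMoment G₀ G₁ U k)ᴴ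
    = -((2 * (k : ℂ)) • quadMoment A₀ A₁ A₂ U (k - 1))
  const : ∀ k, H * U k - (H * U k)ᴴ = ((k * (k - 1) : ℂ) • quadMoment A₀ A₁ A₂ U (k - 2)
    + (k : ℂ) • linMoment G₀ G₁ U (k - 1))ᴴ

/-- The moment of `t ^ k` against the image of `t ^ m` under the operator. -/
def actMoment (A₀ A₁ A₂ G₀ G₁ H : Matrix n n ℂ) (U : ℕ → Matrix n n ℂ) (m k : ℕ) :
    Matrix n n ℂ :=
  (m * (m - 1) : ℂ) • quadMoment A₀ A₁ A₂ U (m + k - 2) + (m : ℂ) • linMoment G₀ G₁ U (m + k - 1)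
    + H * U (m + k)

variable {A₀ A₁ A₂ G₀ G₁ H : Matrix n n ℂ}

/-- For fixed `N = m + k`, the symmetry equation is quadratic in `m`. Its second difference is
`quad`, its first difference given `quad` is `lin`, and its value at `m = 0` is `const`. The
truncated indices only occur with vanishing coefficients. -/
theorem actMoment_symm_iff {U : ℕ → Matrix n n ℂ} :
    (∀ m k, actMoment A₀ A₁ A₂ G₀ G₁ H U m k = (actMoment A₀ A₁ A₂ G₀ G₁ H U k m)ᴴ) ↔
      MomentEquations A₀ A₁ A₂ G₀ G₁ H U := by
  constructor
  · intro h
    have hq : ∀ k, (quadMoment A₀ A₁ A₂ U k)ᴴ = quadMoment A₀ A₁ A₂ U k := by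
      intro k
      have h0 := h 0 (k + 2)
      have h1 := h 1 (k + 1)
      have h2 := h 2 k
      rw [show k + 1 = 1 + k by ring] at h1
      simp only [actMoment, show 0 + (k + 2) = k + 2 by ring, show 1 + (1 + k) = k + 2 by ring,
        show 1 + k + 1 = k + 2 by ring, show 2 + k = k + 2 by ring, Nat.add_sub_cancel,
        show k + 2 + 0 = k + 2 by ring,
        Matrix.conjTranspose_add, Matrix.conjTranspose_smul] at h0 h1 h2
      push_cast at h0 h1 h2
      simp only [star_mul', star_add, star_sub, star_one, star_natCast, star_ofNat] at h0 h1 h2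
      have : (2 : ℂ) • (quadMoment A₀ A₁ A₂ U k)ᴴ = (2 : ℂ) • quadMoment A₀ A₁ A₂ U k := by
        linear_combination (norm := module) -h0 + (2 : ℂ) • h1 - h2
      exact smul_right_injective _ (two_ne_zero' ℂ) this
    refine ⟨hq, fun k => ?_, fun k => ?_⟩
    · have h0 := h 0 (k + 1)
      have h1 := h 1 k
      simp only [actMoment, show 0 + (k + 1) = k + 1 by ring, show 1 + k = k + 1 by ring,
        show k + 1 + 0 = k + 1 by ring, Nat.add_sub_cancel,
        Matrix.conjTranspose_add, Matrix.conjTranspose_smul, hq] at h0 h1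
      push_cast at h0 h1
      simp only [star_mul', star_add, star_sub, star_one, star_natCast] at h0 h1
      linear_combination (norm := module) h1 - h0
    · have h0 := h 0 k
      simp only [actMoment, zero_add, add_zero, Matrix.conjTranspose_add] at h0
      rw [Matrix.conjTranspose_add]
      push_cast at h0
      linear_combination (norm := module) h0
  · intro h m k
    have h1 := h.lin (m + k - 1)
    have h2 := h.const (m + k)
    have h0 := h.quad (m + k - 2)
    simp only [actMoment]
    rw [add_comm k m]
    simp only [Matrix.conjTranspose_add, Matrix.conjTranspose_smul, star_mul', star_add, star_sub,
      star_one, star_natCast, h0, Nat.cast_add] at h1 h2 ⊢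
    rcases Nat.eq_zero_or_pos (m + k) with hN | hN
    · obtain ⟨rfl, rfl⟩ : m = 0 ∧ k = 0 := by omega
      simp only [Nat.cast_zero] at h2 ⊢
      linear_combination (norm := module) h2
    -- Once `quad` holds, the equation is affine in `m` along `m + k = N`: `const` is its value at
    -- `0` and `lin` at `N - 1` its slope.
    · rw [Nat.cast_sub (by omega), show m + k - 1 - 1 = m + k - 2 by omega] at h1
      push_cast at h1
      linear_combination (norm := module) h2 + (m : ℂ) • h1

theorem act_X_pow {D : SecondOrderOperator n} (hF₂ : D.F₂ = C A₀ + X * C A₁ + X ^ 2 * C A₂)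
    (hF₁ : D.F₁ = C G₀ + X * C G₁) (hF₀ : D.F₀ = C H) (m : ℕ) :
    D.act (X ^ m) =
      C ((m * (m - 1) : ℂ) • (1 : Matrix n n ℂ)) *
        (C A₀ * X ^ (m - 2) + C A₁ * X ^ (m - 2 + 1) + C A₂ * X ^ (m - 2 + 2)) +
      C ((m : ℂ) • (1 : Matrix n n ℂ)) * (C G₀ * X ^ (m - 1) + C G₁ * X ^ (m - 1 + 1)) +
      C H * X ^ m := by
  have hc : ∀ (A : Matrix n n ℂ) (i : ℕ), (X : MatrixPolynomial n) ^ i * C A = C A * X ^ i :=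
    fun A i => X_pow_mul_C A i
  have h1 : ∀ (A : Matrix n n ℂ) (i : ℕ),
      (X : MatrixPolynomial n) ^ i * (X * C A) = C A * X ^ (i + 1) := fun A i => by
    rw [← mul_assoc, ← pow_succ, hc]
  have h2 : ∀ (A : Matrix n n ℂ) (i : ℕ),
      (X : MatrixPolynomial n) ^ i * (X ^ 2 * C A) = C A * X ^ (i + 2) := fun A i => by
    rw [← mul_assoc, ← pow_add, hc]
  have hn : ∀ m : ℕ, (m : Matrix n n ℂ) = (m : ℂ) • (1 : Matrix n n ℂ) := fun m => by
    rw [Nat.cast_smul_eq_nsmul, nsmul_one]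
  have hmm : (m : MatrixPolynomial n) * ((m - 1 : ℕ) : MatrixPolynomial n) =
      C ((m * (m - 1) : ℂ) • (1 : Matrix n n ℂ)) := by
    rw [← C_eq_natCast, ← C_eq_natCast, ← C_mul, hn, hn, smul_mul_smul_comm, one_mul]
    rcases m with _ | m
    · simp
    · simp
  have hd2 : derivative (derivative (X ^ m : MatrixPolynomial n)) =
      C ((m * (m - 1) : ℂ) • (1 : Matrix n n ℂ)) * X ^ (m - 2) := by
    rw [derivative_X_pow, derivative_C_mul, derivative_X_pow, ← mul_assoc, ← hmm, Nat.sub_sub]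
    rfl
  rw [SecondOrderOperator.act, hF₂, hF₁, hF₀, hd2, derivative_X_pow, hn, mul_assoc, mul_assoc,
    mul_add (X ^ (m - 2)), mul_add (X ^ (m - 2)), mul_add (X ^ (m - 1)), h1, h1, h2, hc, hc, hc]

theorem pairing_act_X_pow_left {D : SecondOrderOperator n}
    (hF₂ : D.F₂ = C A₀ + X * C A₁ + X ^ 2 * C A₂) (hF₁ : D.F₁ = C G₀ + X * C G₁)
    (hF₀ : D.F₀ = C H) {W : MatrixMeasure n} (hW : HasMoments W) (m k : ℕ) :
    pairing W (D.act (X ^ m)) (X ^ k) = actMoment A₀ A₁ A₂ G₀ G₁ H (moment W) m k := by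
  rw [act_X_pow hF₂ hF₁ hF₀]
  simp only [pairing_add_left hW, pairing_C_mul_left hW, pairing_X_pow, actMoment, quadMoment,
    linMoment, smul_mul_assoc, one_mul]
  congr 1
  congr 1
  · rcases m with _ | _ | m
    · simp
    · simp
    · simp only [show m + 1 + 1 + k - 2 = m + k by omega,
        show m + 1 + 1 - 2 = m by omega, add_right_comm m _ k]
  · rcases m with _ | m
    · simp
    · simp only [Nat.add_sub_cancel, add_right_comm m 1 k]

theorem pairing_act_X_pow_right {D : SecondOrderOperator n}
    (hF₂ : D.F₂ = C A₀ + X * C A₁ + X ^ 2 * C A₂) (hF₁ : D.F₁ = C G₀ + X * C G₁)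
    (hF₀ : D.F₀ = C H) {W : MatrixMeasure n} (hW : HasMoments W)
    (hH : ∀ k, (moment W k).IsHermitian) (m k : ℕ) :
    pairing W (X ^ k) (D.act (X ^ m)) = (actMoment A₀ A₁ A₂ G₀ G₁ H (moment W) m k)ᴴ := by
  rw [← pairing_act_X_pow_left hF₂ hF₁ hF₀ hW, act_X_pow hF₂ hF₁ hF₀]
  simp only [pairing_add_left hW, pairing_C_mul_left hW, pairing_add_right hW,
    pairing_C_mul_right hW, pairing_X_pow, Matrix.conjTranspose_add, Matrix.conjTranspose_mul,
    (hH _).eq, add_comm k]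

theorem isSymmetric_iff_momentEquations {D : SecondOrderOperator n}
    (hF₂ : D.F₂ = C A₀ + X * C A₁ + X ^ 2 * C A₂) (hF₁ : D.F₁ = C G₀ + X * C G₁)
    (hF₀ : D.F₀ = C H) {W : MatrixMeasure n} (hW : HasMoments W)
    (hH : ∀ k, (moment W k).IsHermitian) :
    D.IsSymmetric W ↔ MomentEquations A₀ A₁ A₂ G₀ G₁ H (moment W) := by
  rw [isSymmetric_iff_X_pow hW, ← actMoment_symm_iff]
  simp only [pairing_act_X_pow_left hF₂ hF₁ hF₀ hW, pairing_act_X_pow_right hF₂ hF₁ hF₀ hW hH]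

end MomentEquations

/-! ### Solving the moment equations algebraically -/

section MomentRecursion

variable {K : Type*} [Field K]

/-- Here `y` and `w` stand for the two off-diagonal entries of a Hermitian moment sequence, so their
equality makes the moments real. If `s ≠ 0`, the lower right quadratic equation suffices. If `s =
0`, the other quadratic equations give it from index `1` on, and index `0` needs the linear
equation. -/
theorem laguerre_offDiag_eq {a r s α p q : K} (hα : α = a * r - s - 1) (hq : q = p - a * (s - 1))
    (hrel : q ^ 2 + (2 * a * s - (1 + a ^ 2) * r) * q - s ^ 2 = 0)
    (hb : 1 + a ^ 2 ≠ 0) (h1 : α + 1 ≠ 0) (h3 : α + 3 ≠ 0)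
    {x y w z : ℕ → K}
    (e1d : ∀ k, s * (y k - w k) = 0)
    (e1 : ∀ k, a * s * y k + a ^ 2 * s * z k + (p - (1 + a ^ 2) * r + a) * y (k + 1)
      - (1 + a ^ 2) * (a * r) * z (k + 1) + (1 + a ^ 2) * (1 + α) * z (k + 2)
      = -s * x k - a * s * y k + (p + a) * y (k + 1))
    (e1' : ∀ k, a * s * w k + a ^ 2 * s * z k + (p - (1 + a ^ 2) * r + a) * w (k + 1)
      - (1 + a ^ 2) * (a * r) * z (k + 1) + (1 + a ^ 2) * (1 + α) * z (k + 2)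
      = -s * x k - a * s * w k + (p + a) * w (k + 1))
    {g12 h12 : K}
    (e2 : (-(a * (3 * s - 2 + (α + 1) ^ 2)) + (α + 3) * (p - r)) * y 0 + g12 * z 0
      + (-p + a * (s - 1) + r) * y 1 + h12 * z 1 + (s - α - 1) * x 0
      + (p * (α + 1) - a * α * s) * y 0 + (-p + a * α) * y 1 = 0)
    (e2' : (-(a * (3 * s - 2 + (α + 1) ^ 2)) + (α + 3) * (p - r)) * w 0 + g12 * z 0
      + (-p + a * (s - 1) + r) * w 1 + h12 * z 1 + (s - α - 1) * x 0
      + (p * (α + 1) - a * α * s) * w 0 + (-p + a * α) * w 1 = 0) :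
    ∀ k, y k = w k := by
  by_cases hs : s = 0
  · subst hs
    have hr : r ≠ 0 := by
      rintro rfl
      apply h1
      linear_combination hα
    have hv : ∀ k, y (k + 1) = w (k + 1) := fun k => by
      have : (1 + a ^ 2) * r * (y (k + 1) - w (k + 1)) = 0 := by
        linear_combination e1' k - e1 k
      have := (mul_eq_zero.1 this).resolve_left (mul_ne_zero hb hr)
      linear_combination this
    rintro (_ | k)
    swap; · exact hv k
    have h01 := hv 0
    simp only [zero_add] at h01
    have hp : p = q - a := by linear_combination -hq
    -- At `s = 0` the relation leaves `q = 0` or `q = (1 + a ^ 2) * r`; the factor is then `-(1 + a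
    -- ^ 2) * r * (α + 3)` or `q * (α + 1)`, nonzero in both cases.
    have key : ((q - (1 + a ^ 2) * r) * (α + 3) + q * (α + 1)) * (y 0 - w 0) = 0 := by
      subst hp hα
      linear_combination e2 - e2' - (-(q - a) + a * (0 - 1) + r - (q - a) + a * (a * r - 0 - 1)) * h01
    have hqq : q * (q - (1 + a ^ 2) * r) = 0 := by linear_combination hrel
    rcases mul_eq_zero.1 hqq with h0 | h0
    · subst h0
      have := (mul_eq_zero.1 key).resolve_left (by
        simpa using ⟨⟨hb, hr⟩, h3⟩)
      linear_combination this
    · rw [h0] at key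
      have hq0 : q ≠ 0 := by
        rw [sub_eq_zero.1 h0]
        exact mul_ne_zero hb hr
      have := (mul_eq_zero.1 key).resolve_left (by simpa using ⟨hq0, h1⟩)
      linear_combination this
  · intro k
    have := (mul_eq_zero.1 (e1d k)).resolve_left hs
    linear_combination this

/-- The solutions of the moment equations form the plane spanned by the moments of the
Laguerre weight and those of the point mass. -/
theorem exists_laguerre_moments {a r s α p q d f21 : K}
    (hα : α = a * r - s - 1) (hq : q = p - a * (s - 1))
    (hrel : q ^ 2 + (2 * a * s - (1 + a ^ 2) * r) * q - s ^ 2 = 0)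
    (hf : f21 * (1 + a ^ 2) = 1 + α)
    (hd : 2 * d = -p + a * (s - 1) + (α + 2) * r - 2 * a * f21)
    (hb : 1 + a ^ 2 ≠ 0) (h1 : α + 1 ≠ 0) (hsq : s ≠ 0 → s ^ 2 + q ^ 2 ≠ 0)
    {x y z : ℕ → K}
    (e1 : ∀ k, a * s * y k + a ^ 2 * s * z k + (p - (1 + a ^ 2) * r + a) * y (k + 1)
      - (1 + a ^ 2) * (a * r) * z (k + 1) + (1 + a ^ 2) * (1 + α) * z (k + 2)
      = -s * x k - a * s * y k + (p + a) * y (k + 1))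
    (e22 : ∀ k : ℕ, (s - α - 1) * y k + (p * (α + 1) - a * α * s) * z k + (-p + a * α) * z (k + 1)
      = -k * (-s * y (k - 1) - a * s * z (k - 1) + (p + a) * z (k - 1 + 1)))
    (e12 : ∀ k : ℕ, (-(a * (3 * s - 2 + (α + 1) ^ 2)) + (α + 3) * (p - r)) * y k
      + ((2 * a * p - (1 + a ^ 2) * (α ^ 2 + 2 * s + 3 * α))
          + α * s * (a ^ 2 - 1) - (s + α + 3)) * z k
      + (-p + a * (s - 1) + r) * y (k + 1)
      + ((1 + a ^ 2) * (α ^ 2 + 3 * α - s * α + 2) + 2 * (α + 1)) * z (k + 1)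
      + (s - α - 1) * x k + (p * (α + 1) - a * α * s) * y k + (-p + a * α) * y (k + 1)
      = -(2 * k) * (-s * x (k - 1) - a * s * y (k - 1) + (p + a) * y (k - 1 + 1)))
    (e11 : ∀ k : ℕ, (-(a * (3 * s - 2 + (α + 1) ^ 2)) + (α + 3) * (p - r)) * x k
      + ((2 * a * p - (1 + a ^ 2) * (α ^ 2 + 2 * s + 3 * α))
          + α * s * (a ^ 2 - 1) - (s + α + 3)) * y k
      + (-p + a * (s - 1) + r) * x (k + 1)
      + ((1 + a ^ 2) * (α ^ 2 + 3 * α - s * α + 2) + 2 * (α + 1)) * y (k + 1)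
      = -k * (a * s * x (k - 1) + a ^ 2 * s * y (k - 1)
          + (p - (1 + a ^ 2) * r + a) * x (k - 1 + 1)
          - (1 + a ^ 2) * (a * r) * y (k - 1 + 1) + (1 + a ^ 2) * (1 + α) * y (k - 1 + 2)))
    (e3 : d * y 0 + (1 + a * α * p - α * (s - 1) * (a ^ 2 + α + 2) + f21) * z 0
      = f21 * x 0 - d * y 0) :
    ∃ (g : ℕ → K) (ζ : K), (∀ k : ℕ, g (k + 1) = (α + 1 + k) * g k) ∧
      ∀ k, z k = g k + ζ * s ^ k ∧
        y k = a * (g (k + 1) - g k) + ζ * s ^ k * p ∧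
        x k = g (k + 2) + a ^ 2 * (g (k + 2) - 2 * g (k + 1) + g k) + ζ * s ^ k * p ^ 2 := by
  have hp : p = q + a * (s - 1) := by linear_combination -hq
  -- `X`, `Y`, `z` are the entries after removing the unipotent factor with off-diagonal entry `a *
  -- (t - 1)`; multiplication by `t` is the index shift.
  obtain ⟨Y, hY⟩ : ∃ Y : ℕ → K, ∀ k, y k = Y k + a * (z (k + 1) - z k) :=
    ⟨fun k => y k - a * (z (k + 1) - z k), fun k => by ring⟩
  obtain ⟨X, hX⟩ : ∃ X : ℕ → K, ∀ k, x k = X k + 2 * a * (Y (k + 1) - Y k)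
      + a ^ 2 * (z (k + 2) - 2 * z (k + 1) + z k) :=
    ⟨fun k => x k - 2 * a * (Y (k + 1) - Y k) - a ^ 2 * (z (k + 2) - 2 * z (k + 1) + z k),
      fun k => by ring⟩
  suffices H : ∃ (g : ℕ → K) (ζ : K), (∀ k : ℕ, g (k + 1) = (α + 1 + k) * g k) ∧
      ∀ k, z k = g k + ζ * s ^ k ∧ Y k = ζ * s ^ k * q ∧ X k = g (k + 2) + ζ * s ^ k * q ^ 2 by
    obtain ⟨g, ζ, hg, H⟩ := H
    refine ⟨g, ζ, hg, fun k => ⟨(H k).1, ?_, ?_⟩⟩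
    · rw [hY, (H k).1, (H (k + 1)).1, (H k).2.1, hp]
      ring
    · rw [hX, (H k).1, (H (k + 1)).1, (H (k + 2)).1, (H k).2.1, (H (k + 1)).2.1, (H k).2.2, hp]
      ring
  have E1 : ∀ k, s * X k + (2 * a * s - (1 + a ^ 2) * r) * Y (k + 1) - s * z (k + 2) = 0 := by
    intro k
    have := e1 k
    rw [hX, hY, hY, hp, hα] at this
    linear_combination this
  have E22z : q * (z 1 - (α + 1) * z 0) = (s - α - 1) * Y 0 := by
    have := e22 0
    rw [hY, hp] at this
    push_cast at this
    rw [hα] at this ⊢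
    linear_combination -this
  have E22 : ∀ k : ℕ, q * (z (k + 2) - (α + 2 + k) * z (k + 1))
      = (s - α - 1) * Y (k + 1) - (k + 1) * s * Y k := by
    intro k
    have := e22 (k + 1)
    simp only [Nat.add_sub_cancel] at this
    rw [hY, hY, hp] at this
    push_cast at this
    rw [hα] at this ⊢
    linear_combination -this
  have E12z : (q + (2 * a * s - (1 + a ^ 2) * r)) * ((α + 3) * Y 0 - Y 1)
      + (s + α + 1) * z 2 - 2 * s * (α + 2) * z 1 + (s - α - 1) * X 0
      + q * ((α + 1) * Y 0 - Y 1) = 0 := by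
    have h := e12 0
    have h0 := E22z
    have h1 := E22 0
    rw [hX, hY, hY, hp] at h
    push_cast at h h1
    rw [hα] at h h0 h1 ⊢
    simp only [zero_add] at h h1
    linear_combination h + 2 * a * (h1 - h0)
  have E12 : ∀ k : ℕ, (q + (2 * a * s - (1 + a ^ 2) * r)) * ((α + 3) * Y (k + 1) - Y (k + 2))
      + (s + α + 1) * z (k + 3) - 2 * s * (α + 2) * z (k + 2) + (s - α - 1) * X (k + 1)
      + q * ((α + 1) * Y (k + 1) - Y (k + 2)) = -(2 * (k + 1)) * (-s * X k + q * Y (k + 1)) := by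
    intro k
    have h := e12 (k + 1)
    have h0 := E22 k
    have h1 := E22 (k + 1)
    simp only [Nat.add_sub_cancel] at h
    rw [hX, hX, hY, hY, hY, hp] at h
    push_cast at h h1
    rw [hα] at h h0 h1 ⊢
    linear_combination h + 2 * a * (h1 - h0)
  by_cases hs : s = 0
  · subst hs
    have hbr : (1 + a ^ 2) * r ≠ 0 := by
      refine mul_ne_zero hb ?_
      rintro rfl
      apply h1
      linear_combination hα
    have hY0 : ∀ k, Y (k + 1) = 0 := fun k => by
      refine (mul_eq_zero.1 (?_ : (1 + a ^ 2) * r * Y (k + 1) = 0)).resolve_left hbr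
      linear_combination -E1 k
    have hqq : q * (q - (1 + a ^ 2) * r) = 0 := by linear_combination hrel
    rcases mul_eq_zero.1 hqq with h0 | h0
    · subst h0
      have hY00 : Y 0 = 0 := by
        refine (mul_eq_zero.1 (?_ : (α + 1) * Y 0 = 0)).resolve_left h1
        linear_combination E22z
      have hYk : ∀ k, Y k = 0 := by
        rintro (_ | k)
        exacts [hY00, hY0 k]
      have hXk : ∀ k, X k = z (k + 2) := by
        rintro (_ | k) <;> refine sub_eq_zero.1 ((mul_eq_zero.1 (?_ : (α + 1) * (_ - _) = 0)).resolve_left h1)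
        · simp only [hYk] at E12z
          linear_combination -E12z
        · have := E12 k
          simp only [hYk] at this
          linear_combination -this
      -- With `q = 0` and `Y = 0` the lower right linear equation is vacuous, so the recursion must
      -- come from `e3` for this index and from `e11` for later ones.
      have hz2 : z 2 = (α + 2) * z 1 := by
        refine sub_eq_zero.1 ((mul_eq_zero.1 (?_ : (α + 1) * (_ - _) = 0)).resolve_left h1)
        have := e3
        rw [hX, hY, hYk, hYk, hXk, hp] at this
        simp only [zero_add] at this
        linear_combination -this + a * (z 1 - z 0) * hd + (z 0 - z 2) * hf
          - (α + 2) * (z 1 - z 0) * hα - a * (z 1 - z 0) * hp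
      have hz3 : ∀ k : ℕ, z (k + 3) = (α + 3 + k) * z (k + 2) := by
        intro k
        refine sub_eq_zero.1 ((mul_eq_zero.1 (?_ : (1 + a ^ 2) * r * (_ - _) = 0)).resolve_left hbr)
        have := e11 k
        rcases k with _ | k
        · simp only [hX, hY, hYk, hXk, hp] at this
          push_cast at this ⊢
          rw [hα] at this ⊢
          simp only [zero_add] at this ⊢
          linear_combination this
        · simp only [hX, hY, hYk, hXk, hp, Nat.add_sub_cancel] at this
          push_cast at this ⊢
          rw [hα] at this ⊢
          linear_combination this
      -- A mass at the origin contributes to moment `0` only, as `0 ^ 0 = 1`. Running the recursion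
      -- back from `z 1` gives the Laguerre part of `z 0`; the remainder is the mass.
      refine ⟨fun k => if k = 0 then z 1 / (α + 1) else z k, z 0 - z 1 / (α + 1), ?_, ?_⟩
      · rintro (_ | _ | k)
        · simp
          field_simp
        · simp only [zero_add, one_ne_zero, if_false, Nat.reduceAdd, OfNat.ofNat_ne_zero, hz2]
          push_cast
          ring
        · simp only [Nat.add_eq_zero_iff, one_ne_zero, and_false, if_false]
          rw [hz3]
          push_cast
          ring
      · rintro (_ | k)
        · simp [hXk, hYk]
        · simp [hXk, hYk]
    · have hbrq : (1 + a ^ 2) * r = q := by linear_combination -h0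
      have hq0 : q ≠ 0 := hbrq ▸ hbr
      have hXk : X 0 = z 2 + q * Y 0 := by
        refine sub_eq_zero.1 ((mul_eq_zero.1 (?_ : (α + 1) * (_ - _) = 0)).resolve_left h1)
        have h01 := hY0 0
        rw [zero_add] at h01
        rw [h01, hbrq] at E12z
        linear_combination -E12z
      have hXk' : ∀ k, X (k + 1) = z (k + 3) := by
        intro k
        refine sub_eq_zero.1 ((mul_eq_zero.1 (?_ : (α + 1) * (_ - _) = 0)).resolve_left h1)
        have := E12 k
        rw [hY0, hY0] at this
        linear_combination -this
      have hz1 : z 1 = (α + 1) * (z 0 - Y 0 / q) := by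
        field_simp
        linear_combination E22z
      have hz2 : ∀ k : ℕ, z (k + 2) = (α + 2 + k) * z (k + 1) := by
        intro k
        refine sub_eq_zero.1 ((mul_eq_zero.1 (?_ : q * (_ - _) = 0)).resolve_left hq0)
        have := E22 k
        rw [hY0] at this
        linear_combination this
      -- Now `q ≠ 0`, and the mass is forced by `Y 0 = ζ * q`.
      refine ⟨fun k => if k = 0 then z 0 - Y 0 / q else z k, Y 0 / q, ?_, ?_⟩
      · rintro (_ | k)
        · simp [hz1]
        · simp only [Nat.add_eq_zero_iff, one_ne_zero, and_false, if_false]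
          rw [hz2]
          push_cast
          ring
      · rintro (_ | k)
        · refine ⟨by simp, by simp [hq0], ?_⟩
          simp [hXk]
          field_simp
        · simp [hXk', hY0]
  · have hq0 : q ≠ 0 := by
      rintro rfl
      exact hs (by simpa using hrel)
    have hYk : ∀ k, Y (k + 1) = s * Y k := by
      intro k
      -- Eliminating `X` and `z` between `E12`, `E1` and `E22`, then reducing by `hrel`, leaves only
      -- `Y (k + 1) - s * Y k`, with this factor.
      refine (sub_eq_zero.1 ((mul_eq_zero.1 (?_ : (α + 1) * (s ^ 2 + q ^ 2) * (_ - _) = 0)).resolve_left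
        (mul_ne_zero h1 (hsq hs))))
      rcases k with _ | k
      · have h2 := E22 0
        push_cast at h2
        linear_combination -q * s * E12z + (s - α - 1) * q * E1 0 + 2 * s ^ 2 * h2
          + (s * ((α + 3) * Y 0 - Y 1) - (s - α - 1) * Y 1) * hrel
      · have h2 := E22 (k + 1)
        push_cast at h2
        linear_combination -q * s * E12 k + (s - α - 1) * q * E1 (k + 1) + 2 * s ^ 2 * h2
          - 2 * (k + 1) * q * s * E1 k
          + (s * ((α + 3) * Y (k + 1) - Y (k + 2)) - (s - α - 1) * Y (k + 2)
            + 2 * (k + 1) * s * Y (k + 1)) * hrel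
    have hYs : ∀ k, Y k = s ^ k * Y 0 := by
      intro k
      induction k with
      | zero => simp
      | succ k ih => rw [hYk, ih, pow_succ]; ring
    refine ⟨fun k => z k - Y 0 / q * s ^ k, Y 0 / q, ?_, ?_⟩
    · have e : q * (Y 0 / q) = Y 0 := by field_simp
      rintro (_ | k) <;> refine mul_left_cancel₀ hq0 ?_
      · simp only [zero_add, pow_zero, pow_one, Nat.cast_zero]
        linear_combination E22z - (s - α - 1) * e
      · have := E22 k
        rw [hYs (k + 1), hYs k] at this
        push_cast
        linear_combination this - (s ^ (k + 2) - (α + 2 + k) * s ^ (k + 1)) * e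
    · intro k
      refine ⟨by ring, ?_, ?_⟩
      · rw [hYs]; field_simp
      · have e : q * (Y 0 / q) = Y 0 := by field_simp
        refine mul_left_cancel₀ hs (mul_left_cancel₀ hq0 ?_)
        have := E1 k
        rw [hYs] at this
        linear_combination q * this - s ^ (k + 1) * Y 0 * hrel + (s ^ (k + 3) - q ^ 2 * s ^ (k + 1)) * e

end MomentRecursion

/-! ### Determinacy of scalar measures with an exponential moment -/

section Determinacy

open ProbabilityTheory

/-- All Taylor terms of `cosh` are nonnegative, so Tonelli applies even if the integral is infinite.
Thus the even moments alone decide whether `cosh (c * t)` is integrable. -/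
theorem lintegral_cosh_eq_tsum {μ : Measure ℝ} (hμ : ∀ k : ℕ, Integrable (fun t : ℝ => t ^ k) μ)
    (c : ℝ) :
    ∫⁻ t, ENNReal.ofReal (Real.cosh (c * t)) ∂μ =
      ∑' k : ℕ, ENNReal.ofReal (c ^ (2 * k) / (2 * k).factorial * ∫ t, t ^ (2 * k) ∂μ) := by
  have hpos : ∀ (t : ℝ) (k : ℕ), 0 ≤ (c * t) ^ (2 * k) / ((2 * k).factorial : ℝ) := fun t k => by
    rw [pow_mul]
    positivity
  have h1 : ∀ t, ENNReal.ofReal (Real.cosh (c * t)) =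
      ∑' k : ℕ, ENNReal.ofReal ((c * t) ^ (2 * k) / (2 * k).factorial) := fun t => by
    rw [← (Real.hasSum_cosh (c * t)).tsum_eq,
      ENNReal.ofReal_tsum_of_nonneg (hpos t) (Real.hasSum_cosh (c * t)).summable]
  simp only [h1]
  rw [lintegral_tsum fun k => by fun_prop]
  congr 1
  funext k
  have : (fun t : ℝ => (c * t) ^ (2 * k) / ((2 * k).factorial : ℝ)) =
      fun t => c ^ (2 * k) / ((2 * k).factorial : ℝ) * t ^ (2 * k) := by
    funext t
    ring
  rw [← ofReal_integral_eq_lintegral_ofReal (by rw [this]; exact (hμ _).const_mul _)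
    (Filter.Eventually.of_forall fun t => hpos t k), this, integral_const_mul]

theorem lintegral_cosh_ne_top_iff {μ : Measure ℝ} {c : ℝ} :
    ∫⁻ t, ENNReal.ofReal (Real.cosh (c * t)) ∂μ ≠ ⊤ ↔
      Integrable (fun t => Real.cosh (c * t)) μ := by
  rw [← lintegral_ofReal_ne_top_iff_integrable (by fun_prop)
    (Filter.Eventually.of_forall fun t => (Real.cosh_pos _).le)]

theorem Ioo_subset_interior_integrableExpSet {μ : Measure ℝ} {c : ℝ}
    (h : Integrable (fun t => Real.cosh (c * t)) μ) :
    Set.Ioo (-c) c ⊆ interior (integrableExpSet id μ) := by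
  refine interior_maximal (fun x hx => ?_) isOpen_Ioo
  refine (h.const_mul 2).mono' (by fun_prop) (Filter.Eventually.of_forall fun t => ?_)
  rw [Real.norm_eq_abs, Real.abs_exp, Real.cosh_eq]
  have h0 : x * t ≤ c * t ∨ x * t ≤ -(c * t) := by
    rcases le_total 0 t with ht | ht
    · exact Or.inl (mul_le_mul_of_nonneg_right hx.2.le ht)
    · exact Or.inr (by nlinarith [hx.1])
  rcases h0 with h0 | h0
  · have := Real.exp_le_exp.2 h0
    have := Real.exp_pos (-(c * t))
    simp only [id]
    linarith
  · have := Real.exp_le_exp.2 h0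
    have := Real.exp_pos (c * t)
    simp only [id]
    linarith

/-- A measure with an exponential moment is determined by its moments. -/
theorem ext_of_integral_pow_eq {μ ν : Measure ℝ} [IsFiniteMeasure μ] [IsFiniteMeasure ν] {c : ℝ}
    (hc : 0 < c) (hν : Integrable (fun t => Real.exp (c * |t|)) ν)
    (hμ : ∀ k : ℕ, Integrable (fun t : ℝ => t ^ k) μ)
    (h : ∀ k : ℕ, ∫ t, t ^ k ∂μ = ∫ t, t ^ k ∂ν) : μ = ν := by
  have hcν : Integrable (fun t => Real.cosh (c * t)) ν := by
    refine hν.mono' (by fun_prop) (Filter.Eventually.of_forall fun t => ?_)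
    rw [Real.norm_eq_abs, abs_of_pos (Real.cosh_pos _), ← Real.cosh_abs, abs_mul, abs_of_pos hc, Real.cosh_eq]
    have : Real.exp (-(c * |t|)) ≤ Real.exp (c * |t|) :=
      Real.exp_le_exp.2 (by have := abs_nonneg t; nlinarith)
    linarith
  have hSν := Ioo_subset_interior_integrableExpSet hcν
  have h0ν : (0 : ℝ) ∈ interior (integrableExpSet id ν) := hSν ⟨by linarith, hc⟩
  -- The exponential moment is assumed for `ν` only; it passes to `μ` through the equal even
  -- moments.
  have hcμ : Integrable (fun t => Real.cosh (c * t)) μ := by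
    rw [← lintegral_cosh_ne_top_iff] at hcν ⊢
    rw [lintegral_cosh_eq_tsum hμ]
    rw [lintegral_cosh_eq_tsum fun k => integrable_pow_of_mem_interior_integrableExpSet h0ν k] at hcν
    simpa only [h] using hcν
  have hSμ := Ioo_subset_interior_integrableExpSet hcμ
  have h0μ : (0 : ℝ) ∈ interior (integrableExpSet id μ) := hSμ ⟨by linarith, hc⟩
  set S : Set ℂ := {z | z.re ∈ Set.Ioo (-c) c} with hS
  have haμ : AnalyticOnNhd ℂ (complexMGF id μ) S :=
    analyticOnNhd_complexMGF.mono fun z hz => hSμ hz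
  have haν : AnalyticOnNhd ℂ (complexMGF id ν) S :=
    analyticOnNhd_complexMGF.mono fun z hz => hSν hz
  have hz0 : (0 : ℂ) ∈ S := by simp [hS, hc]
  have hder : ∀ k, iteratedDeriv k (complexMGF id μ) 0 = iteratedDeriv k (complexMGF id ν) 0 := by
    intro k
    rw [iteratedDeriv_complexMGF (by simpa using h0μ), iteratedDeriv_complexMGF (by simpa using h0ν)]
    simp only [id, zero_mul, Complex.exp_zero, mul_one, ← Complex.ofReal_pow]
    rw [integral_complex_ofReal, integral_complex_ofReal, h]
  -- Derivatives at `0` are moments, so the Taylor series agree; the identity theorem then extends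
  -- this to the strip, whose imaginary axis carries the characteristic functions.
  have hev : complexMGF id μ =ᶠ[nhds 0] complexMGF id ν := by
    have h1 := (haμ 0 hz0).hasFPowerSeriesAt
    have h2 := (haν 0 hz0).hasFPowerSeriesAt
    simp only [hder] at h1
    filter_upwards [h1.eventually_hasSum, h2.eventually_hasSum] with z hz1 hz2
    simpa using hz1.unique hz2
  have hconv : IsPreconnected S :=
    ((convex_Ioo (-c) c).linear_preimage Complex.reLm).isPreconnected
  have heq := haμ.eqOn_of_preconnected_of_eventuallyEq haν hconv hz0 hev
  refine Measure.ext_of_charFun (funext fun t => ?_)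
  rw [← complexMGF_id_mul_I, ← complexMGF_id_mul_I]
  exact heq (by simp [hS, hc])

end Determinacy

/-! ### Positive matrix measures: densities, quadratic forms, determinacy -/

section Positive

variable {n : Type*} [Fintype n]

/-- The sum of the variations of the entries dominates every entry, and it is finite by the moments
of order `0`. -/
theorem exists_density {W : MatrixMeasure n} (hW : HasMoments W) :
    ∃ (τ : Measure ℝ) (H : n → n → ℝ → ℂ), IsFiniteMeasure τ ∧ (∀ i j, Integrable (H i j) τ) ∧
      ∀ i j, τ.withDensityᵥ (H i j) = W i j := by
  have hfin : ∀ i j, IsFiniteMeasure (W i j).variation := fun i j => by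
    have h : Integrable (fun t : ℝ => t ^ 0) (W i j).variation := hW 0 i j
    simpa [integrable_const_iff] using h
  let τ : Measure ℝ := ∑ i, ∑ j, (W i j).variation
  have hτ : IsFiniteMeasure τ := inferInstance
  have hle : ∀ i j, (W i j).variation ≪ τ := fun i j =>
    Measure.absolutelyContinuous_of_le
      ((Finset.single_le_sum (f := fun j => (W i j).variation) (fun _ _ => Measure.zero_le _)
        (Finset.mem_univ j)).trans
      (Finset.single_le_sum (f := fun i => ∑ j, (W i j).variation) (fun _ _ => Measure.zero_le _)
        (Finset.mem_univ i)))
  choose H hH using fun i j => exists_integrable_withDensityᵥ_eq (hle i j)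
  exact ⟨τ, H, hτ, fun i j => (hH i j).1, fun i j => (hH i j).2⟩

theorem isHermitian_moment {W : MatrixMeasure n}
    (hp : ∀ s : Set ℝ, MeasurableSet s → (setValue W s).IsHermitian) (hW : HasMoments W) (k : ℕ) :
    (moment W k).IsHermitian := by
  obtain ⟨τ, H, hτ, hi, hH⟩ := exists_density hW
  have hmom : ∀ i j, moment W k i j = ∫ t, (t : ℂ) ^ k * H i j t ∂τ := fun i j => by
    rw [moment, Matrix.of_apply, ← hH, integral_withDensityᵥ_mul (hi i j)]
    rw [hH]
    simpa using (hW k i j).ofReal (𝕜 := ℂ)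
  ext i j
  rw [Matrix.conjTranspose_apply, hmom, hmom, ← starRingEnd_apply, ← integral_conj]
  have hc : Integrable (fun t => (starRingEnd ℂ) (H j i t)) τ := by
    simpa using! (RCLike.conjLIE (K := ℂ)).toContinuousLinearEquiv.toContinuousLinearMap.integrable_comp (hi j i)
  have : (fun t => (starRingEnd ℂ) (H j i t)) =ᵐ[τ] H i j := by
    refine hc.ae_eq_of_withDensityᵥ_eq (hi i j) ?_
    ext s hs
    rw [withDensityᵥ_apply hc hs, integral_conj, ← withDensityᵥ_apply (hi j i) hs, hH, hH]
    exact congrFun (congrFun (hp s hs) i) j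
  refine integral_congr_ae (this.mono fun t ht => ?_)
  simp only [map_mul, map_pow, Complex.conj_ofReal]
  rw [← ht]

/-- The scalar measure `v^* W v` of a positive matrix measure `W`. -/
theorem exists_form_measure {W : MatrixMeasure n}
    (hp : ∀ s : Set ℝ, MeasurableSet s → (setValue W s).PosSemidef) (hW : HasMoments W)
    (v : n → ℂ) :
    ∃ μ : Measure ℝ, IsFiniteMeasure μ ∧
      (∀ s, MeasurableSet s → star v ⬝ᵥ setValue W s *ᵥ v = (μ.real s : ℂ)) ∧
      ∀ f : ℝ → ℝ, (∀ i j, (W i j).Integrable f) → Integrable f μ ∧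
        ((∫ t, f t ∂μ : ℝ) : ℂ) = ∑ i, ∑ j, star (v i) * v j *
          (W i j).integral (fun t => (f t : ℂ)) (ContinuousLinearMap.mul ℝ ℂ) := by
  obtain ⟨τ, H, hτ, hi, hH⟩ := exists_density hW
  let h : ℝ → ℂ := fun t => ∑ i, ∑ j, star (v i) * v j * H i j t
  have hh : Integrable h τ := integrable_finsetSum _ fun i _ => integrable_finsetSum _ fun j _ =>
    (hi i j).const_mul _
  have hform : ∀ s, MeasurableSet s → ∫ t in s, h t ∂τ = star v ⬝ᵥ setValue W s *ᵥ v := by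
    intro s hs
    rw [integral_finsetSum _ fun i _ => integrable_finsetSum _ fun j _ =>
      ((hi i j).const_mul _).restrict]
    simp only [dotProduct, Matrix.mulVec, Finset.mul_sum]
    refine Finset.sum_congr rfl fun i _ => ?_
    rw [integral_finsetSum _ fun j _ => ((hi i j).const_mul _).restrict]
    refine Finset.sum_congr rfl fun j _ => ?_
    rw [integral_const_mul, ← withDensityᵥ_apply (hi i j) hs, hH, setValue, Matrix.of_apply,
      Pi.star_apply]
    ring
  -- All set integrals of `h` are nonnegative by positivity of `W`, so `h` agrees almost everywhere
  -- with its real part, which is nonnegative.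
  let k : ℝ → ℝ := fun t => (h t).re
  have hk : Integrable k τ := hh.re
  have hpos : ∀ s, MeasurableSet s → 0 ≤ ∫ t in s, h t ∂τ := fun s hs => by
    rw [hform s hs]
    exact (hp s hs).dotProduct_mulVec_nonneg v
  have hks : ∀ s, MeasurableSet s → ((∫ t in s, k t ∂τ : ℝ) : ℂ) = ∫ t in s, h t ∂τ := by
    intro s hs
    have h1 : ∫ t in s, k t ∂τ = (∫ t in s, h t ∂τ).re := integral_re hh.restrict
    have h2 := (Complex.le_def.1 (hpos s hs)).2
    rw [h1]
    exact Complex.ext (by simp) (by simpa using h2)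
  have hk0 : 0 ≤ᵐ[τ] k := ae_nonneg_of_forall_setIntegral_nonneg hk fun s hs _ => by
    have := hpos s hs
    rw [← hks s hs] at this
    exact_mod_cast this
  have hkh : (fun t => (k t : ℂ)) =ᵐ[τ] h := by
    refine hk.ofReal.ae_eq_of_withDensityᵥ_eq hh ?_
    ext s hs
    rw [withDensityᵥ_apply hk.ofReal hs, withDensityᵥ_apply hh hs, ← hks s hs]
    exact integral_complex_ofReal
  have hkm : AEMeasurable (fun t => ENNReal.ofReal (k t)) τ := hk.1.aemeasurable.ennreal_ofReal
  have hkt : ∀ᵐ t ∂τ, ENNReal.ofReal (k t) < ⊤ := Filter.Eventually.of_forall fun t => by simp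
  refine ⟨τ.withDensity fun t => ENNReal.ofReal (k t), isFiniteMeasure_withDensity_ofReal hk.2,
    fun s hs => ?_, fun f hf => ?_⟩
  · rw [← hform s hs, ← hks s hs, Measure.real, withDensity_apply _ hs,
      ← ofReal_integral_eq_lintegral_ofReal hk.restrict (ae_restrict_of_ae hk0),
      ENNReal.toReal_ofReal (integral_nonneg_of_ae (ae_restrict_of_ae hk0))]
  · have hf' : ∀ i j, (W i j).Integrable (fun t => (f t : ℂ)) := fun i j =>
      (hf i j).ofReal (𝕜 := ℂ)
    have hfH : ∀ i j, Integrable (fun t => (f t : ℂ) * H i j t) τ := fun i j =>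
      integrable_mul_of_integrable_norm_smul (hi i j).1
        ((integrable_variation_withDensityᵥ_iff (hi i j)).1 (by rw [hH]; exact hf' i j))
    have hsum : (fun t => (f t : ℂ) * h t) =
        fun t => ∑ i, ∑ j, star (v i) * v j * ((f t : ℂ) * H i j t) := by
      funext t
      simp only [h, Finset.mul_sum]
      exact Finset.sum_congr rfl fun i _ => Finset.sum_congr rfl fun j _ => by ring
    have hfh : Integrable (fun t => (f t : ℂ) * h t) τ := by
      rw [hsum]
      exact integrable_finsetSum _ fun i _ => integrable_finsetSum _ fun j _ =>
        (hfH i j).const_mul _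
    have hae : (fun t => (f t : ℂ) * h t) =ᵐ[τ] fun t => ((k t * f t : ℝ) : ℂ) := by
      filter_upwards [hkh] with t ht
      rw [← ht]
      push_cast
      ring
    have hto : (fun t => (ENNReal.ofReal (k t)).toReal • f t) =ᵐ[τ] fun t => k t * f t := by
      filter_upwards [hk0] with t ht
      rw [ENNReal.toReal_ofReal ht, smul_eq_mul]
    constructor
    · rw [integrable_withDensity_iff_integrable_smul₀' hkm hkt]
      refine Integrable.congr ?_ hto.symm
      simpa using (hfh.congr hae).re
    · rw [integral_withDensity_eq_integral_toReal_smul₀ hkm hkt, integral_congr_ae hto,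
        ← integral_complex_ofReal, ← integral_congr_ae hae, hsum,
        integral_finsetSum _ fun i _ => integrable_finsetSum _ fun j _ => (hfH i j).const_mul _]
      refine Finset.sum_congr rfl fun i _ => ?_
      rw [integral_finsetSum _ fun j _ => (hfH i j).const_mul _]
      refine Finset.sum_congr rfl fun j _ => ?_
      rw [integral_const_mul, ← hH, integral_withDensityᵥ_mul (hi i j)]
      rw [hH]
      exact hf' i j

/-- A positive matrix measure with an exponential moment is determined by its moments. -/
theorem ext_of_moment_eq {W V : MatrixMeasure n}
    (hpW : ∀ s : Set ℝ, MeasurableSet s → (setValue W s).PosSemidef) (hW : HasMoments W)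
    (hpV : ∀ s : Set ℝ, MeasurableSet s → (setValue V s).PosSemidef) (hV : HasMoments V)
    {c : ℝ} (hc : 0 < c) (hexp : ∀ i j, (V i j).Integrable fun t => Real.exp (c * |t|))
    (h : ∀ k, moment W k = moment V k) : W = V := by
  have key : ∀ s, MeasurableSet s → setValue W s = setValue V s := by
    intro s hs
    have hv : ∀ v : n → ℂ, star v ⬝ᵥ setValue W s *ᵥ v = star v ⬝ᵥ setValue V s *ᵥ v := by
      intro v
      obtain ⟨μ, hμ, hμs, hμi⟩ := exists_form_measure hpW hW v
      obtain ⟨ν, hν, hνs, hνi⟩ := exists_form_measure hpV hV v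
      have : μ = ν := ext_of_integral_pow_eq hc (hνi _ hexp).1 (fun k => (hμi _ (hW k)).1)
        fun k => by
          have h1 := (hμi _ (hW k)).2
          have h2 := (hνi _ (hV k)).2
          simp only [Complex.ofReal_pow] at h1 h2
          have h3 : ∀ i j, (W i j).integral (fun t : ℝ => (t : ℂ) ^ k) (ContinuousLinearMap.mul ℝ ℂ) =
            (V i j).integral (fun t : ℝ => (t : ℂ) ^ k) (ContinuousLinearMap.mul ℝ ℂ) :=
            fun i j => congrFun (congrFun (h k) i) j
          simp only [h3] at h1
          exact_mod_cast h1.trans h2.symm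
      rw [hμs s hs, hνs s hs, this]
    -- A Hermitian matrix with zero quadratic form is positive semidefinite, and then every vector
    -- lies in its kernel.
    have h0 : (setValue W s - setValue V s).PosSemidef :=
      .of_dotProduct_mulVec_nonneg ((hpW s hs).1.sub (hpV s hs).1) fun v => by
        rw [Matrix.sub_mulVec, dotProduct_sub, hv, sub_self]
    refine Matrix.ext_iff_mulVec.mpr fun v => sub_eq_zero.1 ?_
    rw [← Matrix.sub_mulVec, ← h0.dotProduct_mulVec_zero_iff, Matrix.sub_mulVec, dotProduct_sub, hv,
      sub_self]
  ext i j s hs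
  exact congrFun (congrFun (key s hs) i) j

end Positive

/-! ### Point masses -/

section PointMass

set_option linter.unusedSectionVars false

variable {n : Type*} [Fintype n] [DecidableEq n]

theorem integrable_dirac_vectorMeasure {E : Type*} [NormedAddCommGroup E] (t₀ : ℝ) (c : ℂ)
    (f : ℝ → E) : (VectorMeasure.dirac t₀ c).Integrable f := by
  rw [VectorMeasure.Integrable, VectorMeasure.variation_dirac]
  exact (integrable_dirac (by simp)).smul_measure enorm_ne_top

theorem hasMoments_pointMass (t₀ : ℝ) (M : Matrix n n ℂ) : HasMoments (pointMass t₀ M) :=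
  fun _ i j => integrable_dirac_vectorMeasure t₀ (M i j) _

theorem posSemidef_setValue_pointMass {t₀ : ℝ} {M : Matrix n n ℂ} (hM : M.PosSemidef) {s : Set ℝ}
    (hs : MeasurableSet s) : (setValue (pointMass t₀ M) s).PosSemidef := by
  by_cases h : t₀ ∈ s
  · have : setValue (pointMass t₀ M) s = M := by
      ext i j
      exact VectorMeasure.dirac_apply_of_mem hs h
    rwa [this]
  · have : setValue (pointMass t₀ M) s = 0 := by
      ext i j
      exact VectorMeasure.dirac_apply_of_notMem h
    rw [this]
    exact .zero

theorem pairing_pointMass (t₀ : ℝ) (M : Matrix n n ℂ) (P Q : MatrixPolynomial n) :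
    pairing (pointMass t₀ M) P Q = evalAt P t₀ * M * (evalAt Q t₀)ᴴ := by
  ext i j
  simp only [pairing, pointMass, Matrix.of_apply, VectorMeasure.integral_dirac,
    ContinuousLinearMap.mul_apply', Matrix.mul_apply, Finset.sum_mul, Matrix.conjTranspose_apply]
  rw [Finset.sum_comm]
  exact Finset.sum_congr rfl fun k _ => Finset.sum_congr rfl fun l _ => by ring

theorem moment_pointMass (t₀ : ℝ) (M : Matrix n n ℂ) (k : ℕ) :
    moment (pointMass t₀ M) k = (t₀ : ℂ) ^ k • M := by
  ext i j
  simp [moment, pointMass, VectorMeasure.integral_dirac]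

/-- At `t₀` the derivatives of `P` meet only `F₂(t₀) M` and `F₁(t₀) M`, which vanish, so both sides
equal `P(t₀) F₀ M Q(t₀)^*`. -/
theorem isSymmetric_pointMass {D : SecondOrderOperator n} {t₀ : ℝ} {M : Matrix n n ℂ}
    (hM : M.IsHermitian) (h₂ : evalAt D.F₂ t₀ * M = 0) (h₁ : evalAt D.F₁ t₀ * M = 0)
    (h₀ : evalAt D.F₀ t₀ * M = M * (evalAt D.F₀ t₀)ᴴ) : D.IsSymmetric (pointMass t₀ M) := by
  have key : ∀ P, evalAt (D.act P) t₀ * M = evalAt P t₀ * (evalAt D.F₀ t₀ * M) := fun P => by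
    rw [SecondOrderOperator.act, evalAt_add, evalAt_add, evalAt_mul, evalAt_mul, evalAt_mul,
      add_mul, add_mul, mul_assoc, mul_assoc, mul_assoc, h₂, h₁, mul_zero, mul_zero, zero_add,
      zero_add]
  intro P Q
  have hQ : M * (evalAt (D.act Q) t₀)ᴴ = M * (evalAt D.F₀ t₀)ᴴ * (evalAt Q t₀)ᴴ := by
    have := congrArg Matrix.conjTranspose (key Q)
    simpa only [Matrix.conjTranspose_mul, hM.eq] using this
  rw [pairing_pointMass, pairing_pointMass, key, h₀, mul_assoc (evalAt P t₀) M, hQ]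
  simp only [mul_assoc]

end PointMass

/-! ### Integrals of positive semidefinite matrix functions -/

section MatrixIntegral

variable {n X : Type*} [Fintype n] [MeasurableSpace X] {ν : Measure X} {h : X → Matrix n n ℂ}

theorem dotProduct_integral_mulVec (hi : ∀ i j, Integrable (fun t => h t i j) ν) (v : n → ℂ) :
    star v ⬝ᵥ (Matrix.of fun i j => ∫ t, h t i j ∂ν) *ᵥ v = ∫ t, star v ⬝ᵥ h t *ᵥ v ∂ν := by
  simp only [dotProduct, Matrix.mulVec, Finset.mul_sum, Matrix.of_apply]
  rw [integral_finsetSum _ fun i _ => integrable_finsetSum _ fun j _ =>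
    ((hi i j).mul_const _).const_mul _]
  refine Finset.sum_congr rfl fun i _ => ?_
  rw [integral_finsetSum _ fun j _ => ((hi i j).mul_const _).const_mul _]
  refine Finset.sum_congr rfl fun j _ => ?_
  rw [integral_const_mul, integral_mul_const]

theorem posSemidef_integral (hi : ∀ i j, Integrable (fun t => h t i j) ν)
    (hp : ∀ᵐ t ∂ν, (h t).PosSemidef) : (Matrix.of fun i j => ∫ t, h t i j ∂ν).PosSemidef := by
  refine .of_dotProduct_mulVec_nonneg ?_ fun v => ?_
  · ext i j
    rw [Matrix.conjTranspose_apply, Matrix.of_apply, Matrix.of_apply, ← starRingEnd_apply,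
      ← integral_conj]
    exact integral_congr_ae (hp.mono fun t ht => congrFun (congrFun ht.1 i) j)
  · rw [dotProduct_integral_mulVec hi]
    exact integral_nonneg_of_ae (hp.mono fun t ht => ht.dotProduct_mulVec_nonneg v)

/-- If the form of the integral vanishes at `v`, its nonnegative integrand vanishes almost
everywhere, and semidefiniteness upgrades this to `h t *ᵥ v = 0`. -/
theorem posDef_integral (hi : ∀ i j, Integrable (fun t => h t i j) ν)
    (hp : ∀ᵐ t ∂ν, (h t).PosSemidef)
    (h0 : ∀ v : n → ℂ, (∀ᵐ t ∂ν, h t *ᵥ v = 0) → v = 0) :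
    (Matrix.of fun i j => ∫ t, h t i j ∂ν).PosDef := by
  have hps := posSemidef_integral hi hp
  refine .of_dotProduct_mulVec_pos hps.1 fun v hv =>
    lt_of_le_of_ne (hps.dotProduct_mulVec_nonneg v) fun h1 => hv (h0 v ?_)
  have hint : Integrable (fun t => star v ⬝ᵥ h t *ᵥ v) ν := by
    simp only [dotProduct, Matrix.mulVec, Finset.mul_sum]
    exact integrable_finsetSum _ fun i _ => integrable_finsetSum _ fun j _ =>
      ((hi i j).mul_const _).const_mul _
  have hpos := hp.mono fun t ht => Complex.le_def.1 (ht.dotProduct_mulVec_nonneg v)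
  have hre : ∫ t, (star v ⬝ᵥ h t *ᵥ v).re ∂ν = 0 := by
    have h2 : ∫ t, (star v ⬝ᵥ h t *ᵥ v).re ∂ν = (∫ t, star v ⬝ᵥ h t *ᵥ v ∂ν).re := integral_re hint
    rw [h2, ← dotProduct_integral_mulVec hi, ← h1, Complex.zero_re]
  rw [integral_eq_zero_iff_of_nonneg_ae (hpos.mono fun t ht => ht.1) hint.re] at hre
  filter_upwards [hp, hpos, hre] with t ht ht1 ht2
  exact (ht.dotProduct_mulVec_zero_iff v).1 (Complex.ext ht2 ht1.2.symm)

end MatrixIntegral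

/-! ### The Laguerre weight and its moments -/

section Weight

/-- The polynomial part of the density of the Laguerre weight. -/
def laguerrePoly (a : ℝ) : Matrix (Fin 2) (Fin 2) ℝ[X] :=
  !![X ^ 2 + C (a ^ 2) * (X - 1) ^ 2, C a * (X - 1);
     C a * (X - 1), 1]

/-- `B` is conjugate to `diag(1, 0)` by a constant unipotent matrix, so its exponential is explicit.
-/
theorem matPow_laguerreB (a : ℝ) {t : ℝ} (ht : 0 < t) :
    matPow t (laguerreB a) = toC !![t, a * (t - 1); 0, 1] := by
  have hU : (!![1, -(a : ℂ); 0, 1] : Matrix (Fin 2) (Fin 2) ℂ)⁻¹ = !![1, (a : ℂ); 0, 1] :=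
    Matrix.inv_eq_right_inv (by simp [Matrix.one_fin_two])
  have hunit : IsUnit (!![1, -(a : ℂ); 0, 1] : Matrix (Fin 2) (Fin 2) ℂ) := by
    rw [Matrix.isUnit_iff_isUnit_det]
    simp
  have h : (Real.log t : ℂ) • laguerreB a = !![1, -(a : ℂ); 0, 1] *
      Matrix.diagonal ![(Real.log t : ℂ), 0] * (!![1, -(a : ℂ); 0, 1])⁻¹ := by
    rw [hU]
    ext i j
    fin_cases i <;> fin_cases j <;> simp [laguerreB, toC, Matrix.mul_apply, Fin.sum_univ_two, Matrix.vecMul_diagonal]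
  rw [matPow, h, Matrix.exp_conj _ _ hunit, Matrix.exp_diagonal, hU]
  have hexp : Complex.exp (Real.log t : ℂ) = t := by rw [← Complex.ofReal_exp, Real.exp_log ht]
  ext i j
  fin_cases i <;> fin_cases j <;>
    simp [toC, Matrix.mul_apply, Fin.sum_univ_two, Matrix.vecMul_diagonal, Pi.coe_exp, ← Complex.exp_eq_exp_ℂ, hexp,
      mul_sub, mul_comm, ← sub_eq_add_neg]

theorem matPow_conjTranspose {n : Type*} [Fintype n] [DecidableEq n] (t : ℝ) (A : Matrix n n ℂ) :
    matPow t Aᴴ = (matPow t A)ᴴ := by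
  rw [matPow, matPow, ← Matrix.exp_conjTranspose, Matrix.conjTranspose_smul, Complex.star_def,
    Complex.conj_ofReal]

theorem laguerreDensity_apply (a α : ℝ) {t : ℝ} (ht : 0 < t) (i j : Fin 2) :
    laguerreDensity a α t i j =
      ((t ^ α * Real.exp (-t) * (laguerrePoly a i j).eval t : ℝ) : ℂ) := by
  rw [laguerreDensity, matPow_conjTranspose, matPow_laguerreB a ht]
  fin_cases i <;> fin_cases j <;>
    simp [toC, Matrix.mul_apply, Fin.sum_univ_two, laguerrePoly, -mul_eq_mul_left_iff]
  ring

theorem posSemidef_laguerreDensity (a α : ℝ) {t : ℝ} (ht : 0 < t) :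
    (laguerreDensity a α t).PosSemidef := by
  rw [laguerreDensity, matPow_conjTranspose]
  refine (Matrix.posSemidef_self_mul_conjTranspose _).smul ?_
  have : 0 ≤ t ^ α * Real.exp (-t) := by positivity
  exact_mod_cast this

theorem integrableOn_rpow_mul_exp_mul_eval {α b : ℝ} (hα : -1 < α) (hb : 0 < b) (p : ℝ[X]) :
    IntegrableOn (fun t => t ^ α * Real.exp (-b * t) * p.eval t) (Set.Ioi 0) := by
  induction p using Polynomial.induction_on' with
  | add p q hp hq =>
    simpa only [eval_add, mul_add] using! hp.add hq
  | monomial k c =>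
    have h : IntegrableOn (fun t : ℝ => c * (t ^ (α + k) * Real.exp (-b * t ^ (1 : ℝ))))
        (Set.Ioi 0) :=
      (integrableOn_rpow_mul_exp_neg_mul_rpow (by have : (0 : ℝ) ≤ k := k.cast_nonneg; linarith)
        one_pos hb).const_mul c
    refine h.congr_fun (fun t ht => ?_) measurableSet_Ioi
    simp only [eval_monomial, Real.rpow_one]
    rw [Real.rpow_add_natCast (ne_of_gt ht)]
    ring

theorem integrable_laguerreDensity (a : ℝ) {α : ℝ} (hα : -1 < α) (i j : Fin 2) :
    Integrable (fun t => laguerreDensity a α t i j) (volume.restrict (Set.Ioi (0 : ℝ))) := by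
  have h := (integrableOn_rpow_mul_exp_mul_eval hα one_pos (laguerrePoly a i j)).ofReal (𝕜 := ℂ)
  refine IntegrableOn.congr_fun h (fun t ht => ?_) measurableSet_Ioi
  rw [laguerreDensity_apply a α ht]
  simp

theorem laguerreWeight_integrable (a : ℝ) {α : ℝ} (hα : -1 < α) (i j : Fin 2) {f : ℝ → ℝ}
    (hf : IntegrableOn (fun t => t ^ α * Real.exp (-t) * (laguerrePoly a i j).eval t * f t)
      (Set.Ioi 0)) (hm : Measurable f) :
    (laguerreWeight a α i j).Integrable f := by
  rw [laguerreWeight, Matrix.of_apply,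
    integrable_variation_withDensityᵥ_iff (integrable_laguerreDensity a hα i j)]
  refine hf.norm.mono' ?_ ?_
  · exact (integrable_laguerreDensity a hα i j).1.norm.smul hm.aestronglyMeasurable
  · refine (ae_restrict_mem measurableSet_Ioi).mono fun t ht => ?_
    rw [laguerreDensity_apply a α ht, Complex.norm_real, norm_smul, norm_norm, ← norm_mul]

theorem hasMoments_laguerreWeight (a : ℝ) {α : ℝ} (hα : -1 < α) :
    HasMoments (laguerreWeight a α) := fun k i j => by
  refine laguerreWeight_integrable a hα i j ?_ (by fun_prop)
  refine (integrableOn_rpow_mul_exp_mul_eval hα one_pos (laguerrePoly a i j * X ^ k)).congr_fun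
    (fun t _ => ?_) measurableSet_Ioi
  simp only [eval_mul, eval_pow, eval_X, neg_mul, one_mul, mul_assoc]

/-- Half of the decay `e ^ (-t)` is given up; the other half absorbs the polynomial. -/
theorem laguerreWeight_integrable_exp (a : ℝ) {α : ℝ} (hα : -1 < α) (i j : Fin 2) :
    (laguerreWeight a α i j).Integrable fun t => Real.exp (1 / 2 * |t|) := by
  refine laguerreWeight_integrable a hα i j ?_ (by fun_prop)
  refine (integrableOn_rpow_mul_exp_mul_eval hα one_half_pos (laguerrePoly a i j)).congr_fun
    (fun t (ht : 0 < t) => ?_) measurableSet_Ioi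
  simp only
  rw [abs_of_pos ht, show -t = -(1 / 2) * t + -(1 / 2 * t) by ring, Real.exp_add,
    Real.exp_neg (1 / 2 * t)]
  field_simp

theorem posSemidef_setValue_laguerreWeight (a : ℝ) {α : ℝ} (hα : -1 < α) {s : Set ℝ}
    (hs : MeasurableSet s) : (setValue (laguerreWeight a α) s).PosSemidef := by
  have := posSemidef_integral (ν := (volume.restrict (Set.Ioi (0 : ℝ))).restrict s)
    (h := laguerreDensity a α) (fun i j => (integrable_laguerreDensity a hα i j).restrict)
    (ae_restrict_of_ae ((ae_restrict_mem measurableSet_Ioi).mono fun t ht =>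
      posSemidef_laguerreDensity a α ht))
  convert this using 1
  ext i j
  exact withDensityᵥ_apply (integrable_laguerreDensity a hα i j) hs

theorem integral_laguerreWeight (a : ℝ) {α : ℝ} (hα : -1 < α) (i j : Fin 2) {f : ℝ → ℂ}
    (hf : (laguerreWeight a α i j).Integrable f) :
    (laguerreWeight a α i j).integral f (ContinuousLinearMap.mul ℝ ℂ) =
      ∫ t in Set.Ioi 0, f t * laguerreDensity a α t i j :=
  integral_withDensityᵥ_mul (integrable_laguerreDensity a hα i j) hf

theorem integral_rpow_mul_exp_mul_pow {α : ℝ} (hα : -1 < α) (k : ℕ) :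
    ∫ t in Set.Ioi 0, t ^ α * Real.exp (-t) * t ^ k = Real.Gamma (α + 1 + k) := by
  rw [Real.Gamma_eq_integral (by have : (0 : ℝ) ≤ k := k.cast_nonneg; linarith)]
  refine setIntegral_congr_fun measurableSet_Ioi fun t ht => ?_
  rw [show α + 1 + k - 1 = α + k by ring, Real.rpow_add_natCast (ne_of_gt ht)]
  ring

/-- The moments of the Laguerre weight, in terms of the scalar moments `g`. -/
def laguerreMoment (a : ℝ) (g : ℕ → ℝ) (k : ℕ) : Matrix (Fin 2) (Fin 2) ℂ :=
  toC !![g (k + 2) + a ^ 2 * (g (k + 2) - 2 * g (k + 1) + g k), a * (g (k + 1) - g k);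
         a * (g (k + 1) - g k), g k]

theorem moment_laguerreWeight (a : ℝ) {α : ℝ} (hα : -1 < α) (k : ℕ) :
    moment (laguerreWeight a α) k = laguerreMoment a (fun k => Real.Gamma (α + 1 + k)) k := by
  have hmon : ∀ m : ℕ, IntegrableOn (fun t => t ^ α * Real.exp (-t) * t ^ m) (Set.Ioi 0) :=
    fun m => by simpa using integrableOn_rpow_mul_exp_mul_eval hα one_pos (X ^ m)
  have key : ∀ i j, moment (laguerreWeight a α) k i j =
      ((∫ t in Set.Ioi 0, t ^ α * Real.exp (-t) * (laguerrePoly a i j * X ^ k).eval t : ℝ) : ℂ) := by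
    intro i j
    rw [moment, Matrix.of_apply, integral_laguerreWeight a hα, ← integral_complex_ofReal]
    · refine setIntegral_congr_fun measurableSet_Ioi fun t ht => ?_
      rw [laguerreDensity_apply a α ht, eval_mul, eval_pow, eval_X]
      push_cast
      ring
    · simpa using ((hasMoments_laguerreWeight a hα) k i j).ofReal (𝕜 := ℂ)
  have h1 : ∫ t in Set.Ioi 0, t ^ α * Real.exp (-t) * (C a * (X - 1) * X ^ k).eval t =
      a * (Real.Gamma (α + 1 + (k + 1 : ℕ)) - Real.Gamma (α + 1 + k)) := by
    rw [← integral_rpow_mul_exp_mul_pow hα, ← integral_rpow_mul_exp_mul_pow hα,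
      ← integral_sub (hmon _) (hmon _), ← integral_const_mul]
    congr 1
    funext t
    simp
    ring
  have h2 : ∫ t in Set.Ioi 0, t ^ α * Real.exp (-t) *
      ((X ^ 2 + C (a ^ 2) * (X - 1) ^ 2) * X ^ k).eval t =
      Real.Gamma (α + 1 + (k + 2 : ℕ)) + a ^ 2 * (Real.Gamma (α + 1 + (k + 2 : ℕ))
        - 2 * Real.Gamma (α + 1 + (k + 1 : ℕ)) + Real.Gamma (α + 1 + k)) := by
    have e : (fun t => t ^ α * Real.exp (-t) * ((X ^ 2 + C (a ^ 2) * (X - 1) ^ 2) * X ^ k).eval t) =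
        fun t => (1 + a ^ 2) * (t ^ α * Real.exp (-t) * t ^ (k + 2))
          + (-(2 * a ^ 2) * (t ^ α * Real.exp (-t) * t ^ (k + 1))
          + a ^ 2 * (t ^ α * Real.exp (-t) * t ^ k)) := by
      funext t
      simp
      ring
    have hi : IntegrableOn (fun t => -(2 * a ^ 2) * (t ^ α * Real.exp (-t) * t ^ (k + 1))
          + a ^ 2 * (t ^ α * Real.exp (-t) * t ^ k)) (Set.Ioi 0) :=
      ((hmon _).const_mul _).add ((hmon _).const_mul _)
    rw [e, integral_add ((hmon _).const_mul _) hi,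
      integral_add ((hmon _).const_mul _) ((hmon _).const_mul _), integral_const_mul,
      integral_const_mul, integral_const_mul]
    simp only [integral_rpow_mul_exp_mul_pow hα]
    ring
  have h3 : ∫ t in Set.Ioi 0, t ^ α * Real.exp (-t) * ((1 * X ^ k : ℝ[X])).eval t =
      Real.Gamma (α + 1 + k) := by
    rw [← integral_rpow_mul_exp_mul_pow hα]
    simp
  ext i j
  rw [key]
  fin_cases i <;> fin_cases j
  · exact congrArg Complex.ofReal h2
  · exact congrArg Complex.ofReal h1
  · exact congrArg Complex.ofReal h1
  · exact congrArg Complex.ofReal h3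

end Weight

/-! ### The Laguerre moments satisfy the equations -/

section Coefficients

/-- The coefficient of `t ^ 0` in `F₂`. -/
def quadCoeff₀ (a s : ℝ) : Matrix (Fin 2) (Fin 2) ℝ :=
  !![a * s, a ^ 2 * s; -s, -(a * s)]

/-- The coefficient of `t ^ 1` in `F₂`. -/
def quadCoeff₁ (a r p : ℝ) : Matrix (Fin 2) (Fin 2) ℝ :=
  !![p - (1 + a ^ 2) * r + a, -((1 + a ^ 2) * (a * r)); 0, p + a]

/-- The coefficient of `t ^ 2` in `F₂`. -/
def quadCoeff₂ (a α : ℝ) : Matrix (Fin 2) (Fin 2) ℝ :=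
  !![0, (1 + a ^ 2) * (1 + α); 0, 0]

/-- The coefficient of `t ^ 0` in `F₁`. -/
def linCoeff₀ (a r s α p : ℝ) : Matrix (Fin 2) (Fin 2) ℝ :=
  !![-(a * (3 * s - 2 + (α + 1) ^ 2)) + (α + 3) * (p - r),
     (2 * a * p - (1 + a ^ 2) * (α ^ 2 + 2 * s + 3 * α)) + α * s * (a ^ 2 - 1) - (s + α + 3);
     s - α - 1, p * (α + 1) - a * α * s]

/-- The coefficient of `t ^ 1` in `F₁`. -/
def linCoeff₁ (a r s α p : ℝ) : Matrix (Fin 2) (Fin 2) ℝ :=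
  !![-p + a * (s - 1) + r, (1 + a ^ 2) * (α ^ 2 + 3 * α - s * α + 2) + 2 * (α + 1);
     0, -p + a * α]

/-- The coefficient `F₀`. -/
def constCoeff (a s α p d f : ℝ) : Matrix (Fin 2) (Fin 2) ℝ :=
  !![d, 1 + a * α * p - α * (s - 1) * (a ^ 2 + α + 2) + f; f, -d]

/-- After the recursion every moment is a polynomial multiple of a single `g k`, and each entry is a
polynomial identity. Only the off-diagonal entries of `const` use the values of `d` and `f`. Small
`k` are separate because of the truncated indices. The relation for `q` plays no role here: it
concerns the point mass. -/
theorem momentEquations_laguerreMoment {a r s α p d f : ℝ} (hα : α = a * r - s - 1)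
    (hf : f * (1 + a ^ 2) = 1 + α)
    (hd : 2 * d = -p + a * (s - 1) + (α + 2) * r - 2 * a * f) {g : ℕ → ℝ}
    (hg : ∀ k : ℕ, g (k + 1) = (α + 1 + k) * g k) :
    MomentEquations (toC (quadCoeff₀ a s)) (toC (quadCoeff₁ a r p)) (toC (quadCoeff₂ a α))
      (toC (linCoeff₀ a r s α p)) (toC (linCoeff₁ a r s α p)) (toC (constCoeff a s α p d f))
      (laguerreMoment a g) := by
  have h0 := hg 0
  have h1 := hg 1
  have h2 := hg 2
  have h3 := hg 3
  have hfC : (f * (1 + a ^ 2) : ℂ) = 1 + α := by exact_mod_cast hf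
  have hdC : (2 * d : ℂ) = -p + a * (s - 1) + (α + 2) * r - 2 * a * f := by exact_mod_cast hd
  push_cast at h0 h1 h2 h3
  refine ⟨fun k => ?_, fun k => ?_, fun k => ?_⟩
  · have k0 := hg k
    have k1 := hg (k + 1)
    have k2 := hg (k + 2)
    have k3 := hg (k + 3)
    push_cast at k0 k1 k2 k3
    subst hα
    ext i j
    fin_cases i <;> fin_cases j <;>
      simp [quadMoment, laguerreMoment, toC, Matrix.mul_apply, Fin.sum_univ_two, quadCoeff₀,
        quadCoeff₁, quadCoeff₂, k0, k1, k2, k3, add_assoc] <;> ring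
  · rcases k with _ | k
    · subst hα
      ext i j
      fin_cases i <;> fin_cases j <;>
        simp [linMoment, quadMoment, laguerreMoment, toC, Matrix.mul_apply, Fin.sum_univ_two,
          quadCoeff₀, quadCoeff₁, quadCoeff₂, linCoeff₀, linCoeff₁, h0, h1, h2] <;> ring
    · have k0 := hg k
      have k1 := hg (k + 1)
      have k2 := hg (k + 2)
      have k3 := hg (k + 3)
      push_cast at k0 k1 k2 k3
      subst hα
      ext i j
      fin_cases i <;> fin_cases j <;>
        simp [linMoment, quadMoment, laguerreMoment, toC, Matrix.mul_apply, Fin.sum_univ_two,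
          quadCoeff₀, quadCoeff₁, quadCoeff₂, linCoeff₀, linCoeff₁, k0, k1, k2, k3, add_assoc] <;>
        ring
  · subst hα
    push_cast at hdC hfC
    rcases k with _ | _ | k
    · ext i j
      fin_cases i <;> fin_cases j <;>
        simp [linMoment, quadMoment, laguerreMoment, toC, Matrix.mul_apply, Fin.sum_univ_two,
          constCoeff, quadCoeff₀, quadCoeff₁, quadCoeff₂, linCoeff₀, linCoeff₁, h0, h1, h2]
      · ring
      · linear_combination a * ((a * r - s) * g 0 - g 0) * hdC
          + (g 0 - (a * r - s) * ((a * r - s) + 1) * g 0) * hfC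
      · linear_combination -a * ((a * r - s) * g 0 - g 0) * hdC
          - (g 0 - (a * r - s) * ((a * r - s) + 1) * g 0) * hfC
      · ring
    · ext i j
      fin_cases i <;> fin_cases j <;>
        simp [linMoment, quadMoment, laguerreMoment, toC, Matrix.mul_apply, Fin.sum_univ_two,
          constCoeff, quadCoeff₀, quadCoeff₁, quadCoeff₂, linCoeff₀, linCoeff₁, h0, h1, h2, h3]
      · ring
      · linear_combination a * ((a * r - s) * ((a * r - s) + 1) * g 0 - (a * r - s) * g 0) * hdC
          + ((a * r - s) * g 0 - (a * r - s) * ((a * r - s) + 1) * ((a * r - s) + 2) * g 0) * hfC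
      · linear_combination -a * ((a * r - s) * ((a * r - s) + 1) * g 0 - (a * r - s) * g 0) * hdC
          - ((a * r - s) * g 0 - (a * r - s) * ((a * r - s) + 1) * ((a * r - s) + 2) * g 0) * hfC
      · ring
    · have k0 := hg k
      have k1 := hg (k + 1)
      have k2 := hg (k + 2)
      have k3 := hg (k + 3)
      push_cast at k0 k1 k2 k3
      ext i j
      fin_cases i <;> fin_cases j <;>
        simp [linMoment, quadMoment, laguerreMoment, toC, Matrix.mul_apply, Fin.sum_univ_two,
          constCoeff, quadCoeff₀, quadCoeff₁, quadCoeff₂, linCoeff₀, linCoeff₁, k0, k1, k2, k3, add_assoc]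
      · ring
      · linear_combination a * ((a * r - s + k) * ((a * r - s + k) + 1) * ((a * r - s + k) + 2) * g k - (a * r - s + k) * ((a * r - s + k) + 1) * g k) * hdC
          + ((a * r - s + k) * ((a * r - s + k) + 1) * g k - (a * r - s + k) * ((a * r - s + k) + 1) * ((a * r - s + k) + 2) * ((a * r - s + k) + 3) * g k) * hfC
      · linear_combination -a * ((a * r - s + k) * ((a * r - s + k) + 1) * ((a * r - s + k) + 2) * g k - (a * r - s + k) * ((a * r - s + k) + 1) * g k) * hdC
          - ((a * r - s + k) * ((a * r - s + k) + 1) * g k - (a * r - s + k) * ((a * r - s + k) + 1) * ((a * r - s + k) + 2) * ((a * r - s + k) + 3) * g k) * hfC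
      · ring

end Coefficients

/-! ### The moments form a two-parameter real family -/

section Uniqueness

/-- A real sequence with the recursion of the Laguerre moments is a multiple of the sequence of
Laguerre moments. -/
theorem eq_mul_Gamma_of_recursion {α : ℝ} (hα : -1 < α) {g : ℕ → ℝ}
    (hg : ∀ k : ℕ, g (k + 1) = (α + 1 + k) * g k) (k : ℕ) :
    g k = g 0 / Real.Gamma (α + 1) * Real.Gamma (α + 1 + k) := by
  induction k with
  | zero =>
    have := (Real.Gamma_pos_of_pos (by linarith : 0 < α + 1)).ne'
    simp [this]
  | succ k ih =>
    have h : α + 1 + k ≠ 0 := by have : (0 : ℝ) ≤ k := k.cast_nonneg; linarith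
    rw [hg, ih, Nat.cast_succ, ← add_assoc, Real.Gamma_add_one h]
    ring

/-- The algebraic classification is applied over `ℂ`. Hermitian and symmetric moments are real, so
taking real parts gives real parameters, and the recursion identifies the Laguerre part with Gamma
values. -/
theorem exists_moment_eq {a r s α p q d f : ℝ} (hα1 : -1 < α)
    (hα : α = a * r - s - 1) (hq : q = p - a * (s - 1))
    (hrel : q ^ 2 + (2 * a * s - (1 + a ^ 2) * r) * q - s ^ 2 = 0)
    (hf : f * (1 + a ^ 2) = 1 + α)
    (hd : 2 * d = -p + a * (s - 1) + (α + 2) * r - 2 * a * f)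
    {U : ℕ → Matrix (Fin 2) (Fin 2) ℂ} (hU : ∀ k, (U k).IsHermitian)
    (h : MomentEquations (toC (quadCoeff₀ a s)) (toC (quadCoeff₁ a r p)) (toC (quadCoeff₂ a α))
      (toC (linCoeff₀ a r s α p)) (toC (linCoeff₁ a r s α p)) (toC (constCoeff a s α p d f)) U) :
    ∃ γ ζ : ℝ, ∀ k, U k = γ • laguerreMoment a (fun k => Real.Gamma (α + 1 + k)) k +
      ζ • ((s : ℂ) ^ k • toC !![p ^ 2, p; p, 1]) := by
  have hc : ∀ k i j, (starRingEnd ℂ) (U k i j) = U k j i := fun k i j => (hU k).apply j i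
  have hsq : (s : ℂ) ≠ 0 → (s : ℂ) ^ 2 + (q : ℂ) ^ 2 ≠ 0 := fun hs => by
    have hs' : s ≠ 0 := by exact_mod_cast hs
    have : s ^ 2 + q ^ 2 ≠ 0 := by positivity
    exact_mod_cast this
  have hb : (1 + (a : ℂ) ^ 2) ≠ 0 := by
    have : 1 + a ^ 2 ≠ 0 := by positivity
    exact_mod_cast this
  have h1 : (α : ℂ) + 1 ≠ 0 := by
    have : α + 1 ≠ 0 := by linarith
    exact_mod_cast this
  have h3 : (α : ℂ) + 3 ≠ 0 := by
    have : α + 3 ≠ 0 := by linarith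
    exact_mod_cast this
  have hαC : (α : ℂ) = a * r - s - 1 := by exact_mod_cast hα
  have hqC : (q : ℂ) = p - a * (s - 1) := by exact_mod_cast hq
  have hrelC : (q : ℂ) ^ 2 + (2 * a * s - (1 + a ^ 2) * r) * q - s ^ 2 = 0 := by
    exact_mod_cast hrel
  have hfC : (f : ℂ) * (1 + a ^ 2) = 1 + α := by exact_mod_cast hf
  have hdC : (2 : ℂ) * d = -p + a * (s - 1) + (α + 2) * r - 2 * a * f := by exact_mod_cast hd
  have hquad : ∀ k i j, _ := fun k i j => congrFun (congrFun (h.quad k) i) j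
  have hlin : ∀ k i j, _ := fun k i j => congrFun (congrFun (h.lin k) i) j
  have hconst := congrFun (congrFun (h.const 0) 0) 1
  simp [quadMoment, linMoment, toC, Matrix.mul_apply, Fin.sum_univ_two, quadCoeff₀, quadCoeff₁,
    quadCoeff₂, linCoeff₀, linCoeff₁, constCoeff, Fin.forall_fin_two, hc] at hquad hlin hconst
  have hyw : ∀ k, U k 0 1 = U k 1 0 := by
    refine laguerre_offDiag_eq (x := fun k => U k 0 0) (z := fun k => U k 1 1)
      hαC hqC hrelC hb h1 h3 (fun k => ?_) (fun k => ?_) (fun k => ?_)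
      (g12 := (2 * a * p - (1 + a ^ 2) * (α ^ 2 + 2 * s + 3 * α))
          + α * s * (a ^ 2 - 1) - (s + α + 3))
      (h12 := (1 + a ^ 2) * (α ^ 2 + 3 * α - s * α + 2) + 2 * (α + 1)) ?_ ?_
    · rcases (hquad k).2.2 with h0 | h0
      · rw [h0, sub_self, mul_zero]
      · rw [h0, Complex.ofReal_zero, zero_mul]
    · linear_combination -(hquad k).1.2
    · linear_combination (hquad k).2.1
    · have := (hlin 0).1.2
      simp at this
      linear_combination this
    · have := (hlin 0).2.1
      simp at this
      linear_combination this
  obtain ⟨g, ζ, hg, hgz⟩ := exists_laguerre_moments (x := fun k => U k 0 0) (y := fun k => U k 0 1)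
    (z := fun k => U k 1 1) hαC hqC hrelC hfC hdC hb h1 hsq
    (fun k => by linear_combination -(hquad k).1.2)
    (fun k => by
      have := (hlin k).2.2
      simp only [← hyw] at this
      linear_combination this / 2)
    (fun k => by
      have := (hlin k).2.1
      simp only [← hyw] at this
      linear_combination this)
    (fun k => by
      have := (hlin k).1.1
      simp only [← hyw] at this
      linear_combination this / 2)
    (by linear_combination hconst)
  have hre : ∀ k i j, U k i j = ((U k i j).re : ℂ) := fun k i j => by
    refine (Complex.conj_eq_iff_re.1 ?_).symm
    rw [hc]
    fin_cases i <;> fin_cases j <;> first | rfl | exact hyw k | exact (hyw k).symm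
  have hgr : ∀ k : ℕ, (g (k + 1)).re = (α + 1 + k) * (g k).re := fun k => by
    rw [hg, show (α + 1 + k : ℂ) = ((α + 1 + k : ℝ) : ℂ) by push_cast; ring, Complex.re_ofReal_mul]
  have hΓ := eq_mul_Gamma_of_recursion hα1 (g := fun k => (g k).re) hgr
  have hpow : ∀ k, (ζ * (s : ℂ) ^ k).re = ζ.re * s ^ k := fun k => by
    rw [← Complex.ofReal_pow, Complex.re_mul_ofReal]
  refine ⟨(g 0).re / Real.Gamma (α + 1), ζ.re, fun k => ?_⟩
  have hz : (U k 1 1).re = (g k).re + ζ.re * s ^ k := by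
    rw [(hgz k).1, Complex.add_re, hpow]
  have hy : (U k 0 1).re = a * ((g (k + 1)).re - (g k).re) + ζ.re * s ^ k * p := by
    rw [(hgz k).2.1, Complex.add_re, Complex.re_mul_ofReal, hpow, Complex.re_ofReal_mul,
      Complex.sub_re]
  have hx : (U k 0 0).re = (g (k + 2)).re + a ^ 2 * ((g (k + 2)).re - 2 * (g (k + 1)).re + (g k).re)
      + ζ.re * s ^ k * p ^ 2 := by
    rw [(hgz k).2.2, Complex.add_re, ← Complex.ofReal_pow, ← Complex.ofReal_pow p,
      Complex.re_mul_ofReal, hpow, Complex.add_re,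
      Complex.re_ofReal_mul, Complex.add_re, Complex.sub_re]
    simp
  rw [hΓ] at hz
  rw [hΓ, hΓ k] at hy
  rw [hΓ, hΓ (k + 1), hΓ k] at hx
  ext i j
  rw [hre]
  fin_cases i <;> fin_cases j <;> simp only [Fin.zero_eta, Fin.mk_one]
  · rw [hx]
    simp [laguerreMoment, toC]
    ring
  · rw [hy]
    simp [laguerreMoment, toC]
    ring
  · rw [← hyw, hy]
    simp [laguerreMoment, toC]
    ring
  · rw [hz]
    simp [laguerreMoment, toC]

end Uniqueness

/-! ### Nonsingularity, and recovering the weight from its moments -/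

section Weight

/-- The entries of `v^* P` are polynomials with infinitely many roots, hence zero; their top
coefficients say that the invertible leading coefficient kills `v`. -/
theorem eq_zero_of_evalAt_conjTranspose_mulVec {n : Type*} [Fintype n] [DecidableEq n]
    {P : MatrixPolynomial n} (hP : IsUnit P.leadingCoeff) {v : n → ℂ}
    (h : {t : ℝ | (evalAt P t)ᴴ *ᵥ v = 0}.Infinite) : v = 0 := by
  have hp : ∀ i, ∑ j, matPolyEquiv.symm P j i * C (star (v j)) = 0 := fun i => by
    refine eq_zero_of_infinite_isRoot _
      ((h.image Complex.ofReal_injective.injOn).mono ?_)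
    rintro _ ⟨t, ht, rfl⟩
    have := congrArg star (congrFun ht i)
    simpa [Matrix.mulVec, dotProduct, IsRoot, eval_finsetSum, evalAt_apply] using this
  have hl : P.leadingCoeffᴴ *ᵥ v = 0 := by
    funext i
    have := congrArg star (congrArg (fun p => p.coeff P.natDegree) (hp i))
    simpa [Matrix.mulVec, dotProduct, finsetSum_coeff, matPolyEquiv_symm_apply_coeff] using this
  exact Matrix.mulVec_injective_of_isUnit ((Matrix.isUnit_conjTranspose _).2 hP)
    (hl.trans (Matrix.mulVec_zero _).symm)

theorem posDef_laguerreDensity (a α : ℝ) {t : ℝ} (ht : 0 < t) :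
    (laguerreDensity a α t).PosDef := by
  rw [laguerreDensity, matPow_conjTranspose]
  refine (Matrix.PosDef.mul_conjTranspose_self _
    (Matrix.vecMul_injective_of_isUnit (Matrix.isUnit_exp _))).smul ?_
  have : 0 < t ^ α * Real.exp (-t) := by positivity
  exact_mod_cast this

theorem pairing_laguerreWeight (a : ℝ) {α : ℝ} (hα : -1 < α) (P Q : MatrixPolynomial (Fin 2)) :
    (∀ i j, IntegrableOn (fun t => (evalAt P t * laguerreDensity a α t * (evalAt Q t)ᴴ) i j)
      (Set.Ioi 0)) ∧ pairing (laguerreWeight a α) P Q = Matrix.of fun i j =>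
        ∫ t in Set.Ioi 0, (evalAt P t * laguerreDensity a α t * (evalAt Q t)ᴴ) i j := by
  have hW := hasMoments_laguerreWeight a hα
  have hi : ∀ i j k l, IntegrableOn (fun t => evalAt P t i k * star (evalAt Q t j l) *
      laguerreDensity a α t k l) (Set.Ioi 0) := fun i j k l =>
    integrable_mul_of_integrable_norm_smul (integrable_laguerreDensity a hα k l).1
      ((integrable_variation_withDensityᵥ_iff (integrable_laguerreDensity a hα k l)).1
        (hW.integrable_evalAt_mul P Q k l i k j l))
  have he : ∀ i j, (fun t => (evalAt P t * laguerreDensity a α t * (evalAt Q t)ᴴ) i j) =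
      fun t => ∑ k, ∑ l, evalAt P t i k * star (evalAt Q t j l) * laguerreDensity a α t k l := by
    intro i j
    funext t
    simp only [Matrix.mul_apply, Finset.sum_mul, Matrix.conjTranspose_apply]
    rw [Finset.sum_comm]
    exact Finset.sum_congr rfl fun k _ => Finset.sum_congr rfl fun l _ => by ring
  refine ⟨fun i j => ?_, ?_⟩
  · rw [he]
    exact integrable_finsetSum _ fun k _ => integrable_finsetSum _ fun l _ => hi i j k l
  · ext i j
    rw [pairing, Matrix.of_apply, Matrix.of_apply, he,
      integral_finsetSum _ fun k _ => integrable_finsetSum _ fun l _ => hi i j k l]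
    refine Finset.sum_congr rfl fun k _ => ?_
    rw [integral_finsetSum _ fun l _ => hi i j k l]
    exact Finset.sum_congr rfl fun l _ =>
      integral_laguerreWeight a hα k l (hW.integrable_evalAt_mul P Q k l i k j l)

theorem posDef_pairing_laguerreWeight (a : ℝ) {α : ℝ} (hα : -1 < α)
    {P : MatrixPolynomial (Fin 2)} (hP : IsUnit P.leadingCoeff) :
    (pairing (laguerreWeight a α) P P).PosDef := by
  obtain ⟨hi, he⟩ := pairing_laguerreWeight a hα P P
  rw [he]
  refine posDef_integral hi ((ae_restrict_mem measurableSet_Ioi).mono fun t ht =>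
    (posSemidef_laguerreDensity a α ht).mul_mul_conjTranspose_same _) fun v hv => ?_
  have hu : ∀ᵐ t ∂volume.restrict (Set.Ioi (0 : ℝ)), (evalAt P t)ᴴ *ᵥ v = 0 := by
    filter_upwards [hv, ae_restrict_mem measurableSet_Ioi] with t h0 ht
    by_contra hne
    have hpos := (posDef_laguerreDensity a α ht).dotProduct_mulVec_pos hne
    rw [Matrix.star_mulVec, Matrix.conjTranspose_conjTranspose, ← Matrix.dotProduct_mulVec,
      Matrix.mulVec_mulVec, Matrix.mulVec_mulVec, h0, dotProduct_zero] at hpos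
    exact hpos.false
  refine eq_zero_of_evalAt_conjTranspose_mulVec hP fun hfin => ?_
  have h1 : volume.restrict (Set.Ioi (0 : ℝ)) {t : ℝ | (evalAt P t)ᴴ *ᵥ v = 0} = 0 := by
    exact le_antisymm ((Measure.restrict_apply_le _ _).trans (hfin.measure_zero _).le) zero_le
  have h2 : volume.restrict (Set.Ioi (0 : ℝ)) Set.univ = 0 := by
    rw [← Set.compl_union_self {t : ℝ | (evalAt P t)ᴴ *ᵥ v = 0}]
    exact measure_union_null hu h1
  simp at h2

theorem setValue_laguerreWeight_singleton (a : ℝ) {α : ℝ} (hα : -1 < α) (t₀ : ℝ) :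
    setValue (laguerreWeight a α) {t₀} = 0 := by
  ext i j
  rw [setValue, Matrix.of_apply, laguerreWeight, Matrix.of_apply,
    withDensityᵥ_apply (integrable_laguerreDensity a hα i j) (measurableSet_singleton t₀),
    setIntegral_measure_zero _ (by simp)]
  rfl

theorem setValue_laguerreWeight_compl_singleton (a : ℝ) {α : ℝ} (hα : -1 < α) (t₀ : ℝ) :
    setValue (laguerreWeight a α) {t₀}ᶜ 1 1 = (Real.Gamma (α + 1) : ℂ) := by
  rw [setValue, Matrix.of_apply, laguerreWeight, Matrix.of_apply,
    withDensityᵥ_apply (integrable_laguerreDensity a hα 1 1) (measurableSet_singleton t₀).compl,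
    Measure.restrict_congr_set (t := Set.univ)
      (Filter.eventuallyEq_univ.2 (compl_mem_ae_iff.2 (by simp))), Measure.restrict_univ]
  have h := integral_rpow_mul_exp_mul_pow hα 0
  simp only [Nat.cast_zero, add_zero, pow_zero, mul_one] at h
  rw [← h, ← integral_complex_ofReal]
  refine setIntegral_congr_fun measurableSet_Ioi fun t ht => ?_
  rw [laguerreDensity_apply a α ht]
  simp [laguerrePoly]

theorem setValue_combination {n : Type*} (W V : MatrixMeasure n) (γ ζ : ℝ) (s : Set ℝ) :
    setValue (γ • W + ζ • V) s = γ • setValue W s + ζ • setValue V s := rfl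

theorem isSymmetric_combination {n : Type*} [Fintype n] [DecidableEq n]
    {D : SecondOrderOperator n} {W V : MatrixMeasure n}
    (hW : HasMoments W) (hV : HasMoments V) (h₁ : D.IsSymmetric W) (h₂ : D.IsSymmetric V)
    (γ ζ : ℝ) : D.IsSymmetric (γ • W + ζ • V) := fun P Q => by
  simp only [pairing_add_measure (hW.smul γ) (hV.smul ζ), pairing_smul_measure, h₁ P Q, h₂ P Q]

theorem posSemidef_setValue_combination {n : Type*} {W V : MatrixMeasure n}
    (hW : ∀ s, MeasurableSet s → (setValue W s).PosSemidef)
    (hV : ∀ s, MeasurableSet s → (setValue V s).PosSemidef) {γ ζ : ℝ} (hγ : 0 ≤ γ) (hζ : 0 ≤ ζ)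
    (s : Set ℝ) (hs : MeasurableSet s) : (setValue (γ • W + ζ • V) s).PosSemidef := by
  rw [setValue_combination]
  exact ((hW s hs).smul hγ).add ((hV s hs).smul hζ)

theorem isWeightMatrix_combination (a : ℝ) {α : ℝ} (hα : -1 < α) (t₀ : ℝ)
    {M : Matrix (Fin 2) (Fin 2) ℂ} (hM : M.PosSemidef) {γ ζ : ℝ} (hγ : 0 < γ) (hζ : 0 ≤ ζ) :
    IsWeightMatrix (γ • laguerreWeight a α + ζ • pointMass t₀ M) where
  posSemidef := posSemidef_setValue_combination
    (fun _ => posSemidef_setValue_laguerreWeight a hα)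
    (fun _ => posSemidef_setValue_pointMass hM) hγ.le hζ
  moments := ((hasMoments_laguerreWeight a hα).smul γ).add ((hasMoments_pointMass t₀ M).smul ζ)
  nonsingular P hP := by
    rw [pairing_add_measure ((hasMoments_laguerreWeight a hα).smul γ)
      ((hasMoments_pointMass t₀ M).smul ζ), pairing_smul_measure, pairing_smul_measure,
      pairing_pointMass]
    exact (((posDef_pairing_laguerreWeight a hα hP).smul hγ).add_posSemidef
      ((hM.mul_mul_conjTranspose_same _).smul hζ)).isUnit

/-- A weight matrix with the moments of a real combination of the Laguerre weight and a point mass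
is that combination, and its coefficients have the right signs. -/
theorem eq_combination_of_moment_eq (a : ℝ) {α : ℝ} (hα : -1 < α) (t₀ : ℝ)
    {M : Matrix (Fin 2) (Fin 2) ℂ} (hM : M.PosSemidef) (hM1 : M 1 1 = 1)
    {U : MatrixMeasure (Fin 2)} (hU : IsWeightMatrix U) {γ ζ : ℝ}
    (h : ∀ k, moment U k = γ • moment (laguerreWeight a α) k + ζ • moment (pointMass t₀ M) k) :
    0 < γ ∧ 0 ≤ ζ ∧ U = γ • laguerreWeight a α + ζ • pointMass t₀ M := by
  set W := laguerreWeight a α with hWdef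
  set V := pointMass t₀ M with hVdef
  have hW : HasMoments W := hasMoments_laguerreWeight a hα
  have hV : HasMoments V := hasMoments_pointMass t₀ M
  have hpW : ∀ s, MeasurableSet s → (setValue W s).PosSemidef :=
    fun _ => posSemidef_setValue_laguerreWeight a hα
  have hpV : ∀ s, MeasurableSet s → (setValue V s).PosSemidef :=
    fun _ => posSemidef_setValue_pointMass hM
  have hUm : HasMoments U := hU.moments
  -- The signs of `γ` and `ζ` are still unknown and determinacy needs positive measures, so the
  -- negative parts are added to `U`.
  have hparts : (1 : ℝ) • U + (1 : ℝ) • (γ⁻ • W + ζ⁻ • V) = γ⁺ • W + ζ⁺ • V := by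
    refine ext_of_moment_eq
      (posSemidef_setValue_combination hU.posSemidef
        (posSemidef_setValue_combination hpW hpV (negPart_nonneg γ) (negPart_nonneg ζ))
        zero_le_one zero_le_one)
      ((hUm.smul 1).add (((hW.smul _).add (hV.smul _)).smul 1))
      (posSemidef_setValue_combination hpW hpV (posPart_nonneg γ) (posPart_nonneg ζ))
      ((hW.smul _).add (hV.smul _)) one_half_pos
      (fun i j => ((laguerreWeight_integrable_exp a hα i j).smul_vectorMeasure _).add_vectorMeasure
        ((integrable_dirac_vectorMeasure t₀ (M i j) _).smul_vectorMeasure _)) fun k => ?_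
    rw [moment_add (hUm.smul 1) (((hW.smul _).add (hV.smul _)).smul 1), moment_smul, moment_smul,
      moment_add (hW.smul _) (hV.smul _), moment_add (hW.smul _) (hV.smul _), moment_smul,
      moment_smul, moment_smul, moment_smul, h]
    nth_rewrite 1 [← posPart_sub_negPart γ, ← posPart_sub_negPart ζ]
    module
  have hUeq : U = γ • W + ζ • V := by
    rw [one_smul, one_smul] at hparts
    rw [eq_sub_of_add_eq hparts]
    nth_rewrite 3 [← posPart_sub_negPart γ]
    nth_rewrite 3 [← posPart_sub_negPart ζ]
    module
  -- The Laguerre weight has no mass at `t₀`, and the point mass has none on the complement, so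
  -- these two sets isolate `ζ` and `γ` in the lower right entry.
  have hζ : 0 ≤ ζ := by
    have h1 := (hU.posSemidef {t₀} (measurableSet_singleton t₀)).diag_nonneg (i := 1)
    have h2 : setValue V {t₀} 1 1 = 1 := by
      rw [← hM1]
      exact VectorMeasure.dirac_apply_of_mem (measurableSet_singleton t₀) rfl
    rw [hUeq, setValue_combination, setValue_laguerreWeight_singleton a hα, smul_zero, zero_add,
      Matrix.smul_apply, h2, Complex.real_smul, mul_one] at h1
    exact_mod_cast h1
  have hγ : 0 ≤ γ := by
    have h1 := (hU.posSemidef {t₀}ᶜ (measurableSet_singleton t₀).compl).diag_nonneg (i := 1)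
    have h2 : setValue V {t₀}ᶜ 1 1 = 0 := VectorMeasure.dirac_apply_of_notMem (by simp)
    rw [hUeq, setValue_combination, Matrix.add_apply, Matrix.smul_apply, Matrix.smul_apply, h2,
      smul_zero, add_zero, setValue_laguerreWeight_compl_singleton a hα, Complex.real_smul] at h1
    have h3 : 0 ≤ γ * Real.Gamma (α + 1) := by exact_mod_cast h1
    exact nonneg_of_mul_nonneg_left h3 (Real.Gamma_pos_of_pos (by linarith))
  refine ⟨lt_of_le_of_ne hγ ?_, hζ, hUeq⟩
  rintro rfl
  -- If `γ = 0`, the monic polynomial `X - t₀` has zero pairing with itself.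
  have h1 := hU.nonsingular (X - C (Matrix.scalar (Fin 2) (t₀ : ℂ))) (by simp)
  have h2 : evalAt (X - C (Matrix.scalar (Fin 2) (t₀ : ℂ))) t₀ = 0 := by simp [evalAt]
  rw [hUeq, pairing_add_measure (hW.smul _) (hV.smul _), pairing_smul_measure, zero_smul,
    pairing_smul_measure, hVdef, pairing_pointMass, h2] at h1
  simp at h1

end Weight

/-! ### The operator, its mass and the final assembly -/

section Operator

/-- This is the quadratic equation solved by `q = φ - a * (t₀ - 1)`, whose discriminant is the
radicand up to the factor `a ^ 2`; both signs satisfy it since `ε ^ 2 = 1`. -/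
theorem phi_relation (ε : ℤˣ) {a : ℝ} (ha : a ≠ 0) (α t₀ : ℝ) :
    (phi ε a α t₀ - a * (t₀ - 1)) ^ 2 +
      (2 * a * t₀ - (1 + a ^ 2) * ((t₀ + α + 1) / a)) * (phi ε a α t₀ - a * (t₀ - 1)) - t₀ ^ 2
      = 0 := by
  have hΔ := Real.sq_sqrt (show 0 ≤ (a ^ 2 + 1) * (a ^ 2 * (t₀ - α - 1) ^ 2 + (t₀ + α + 1) ^ 2) by
    positivity)
  have hε : (((ε : ℤ) : ℝ)) ^ 2 = 1 := by
    rcases Int.units_eq_one_or ε with rfl | rfl <;> simp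
  rw [phi]
  set R := √((a ^ 2 + 1) * (a ^ 2 * (t₀ - α - 1) ^ 2 + (t₀ + α + 1) ^ 2))
  set e := ((ε : ℤ) : ℝ)
  field_simp
  linear_combination R ^ 2 * hε + hΔ

variable (ε : ℤˣ) {a : ℝ} (α t₀ : ℝ)

theorem laguerreF₂_eq (ha : a ≠ 0) : laguerreF₂ ε a α t₀ = C (toC (quadCoeff₀ a t₀)) +
    X * C (toC (quadCoeff₁ a ((t₀ + α + 1) / a) (phi ε a α t₀))) +
    X ^ 2 * C (toC (quadCoeff₂ a α)) := by
  have h1 : phi ε a α t₀ - (1 + (α + t₀) * (1 + a ^ 2)) / a =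
      phi ε a α t₀ - (1 + a ^ 2) * ((t₀ + α + 1) / a) + a := by
    field_simp
    ring
  have h2 : (α + t₀ + 1) * (1 + a ^ 2) = (1 + a ^ 2) * (a * ((t₀ + α + 1) / a)) := by
    field_simp
    ring
  rw [laguerreF₂, h1, h2]
  rfl

theorem laguerreF₁_eq : laguerreF₁ ε a α t₀ =
    C (toC (linCoeff₀ a ((t₀ + α + 1) / a) t₀ α (phi ε a α t₀))) +
      X * C (toC (linCoeff₁ a ((t₀ + α + 1) / a) t₀ α (phi ε a α t₀))) := rfl

theorem laguerreF₀_eq : laguerreF₀ ε a α t₀ =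
    toC (constCoeff a t₀ α (phi ε a α t₀) (laguerreF₀Diag ε a α t₀) ((1 + α) / (1 + a ^ 2))) := rfl

theorem eq_mul_sub_sub (ha : a ≠ 0) : α = a * ((t₀ + α + 1) / a) - t₀ - 1 := by
  field_simp
  ring

theorem offDiag_mul_eq : (1 + α) / (1 + a ^ 2) * (1 + a ^ 2) = 1 + α :=
  div_mul_cancel₀ _ (by positivity)

theorem two_mul_laguerreF₀Diag (ha : a ≠ 0) : 2 * laguerreF₀Diag ε a α t₀ =
    -phi ε a α t₀ + a * (t₀ - 1) + (α + 2) * ((t₀ + α + 1) / a)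
      - 2 * a * ((1 + α) / (1 + a ^ 2)) := by
  rw [laguerreF₀Diag]
  have : 1 + a ^ 2 ≠ 0 := by positivity
  field_simp

theorem posSemidef_mass : (mass ε a α t₀).PosSemidef := by
  have : mass ε a α t₀ = Matrix.vecMulVec ![(phi ε a α t₀ : ℂ), 1]
      (star ![(phi ε a α t₀ : ℂ), 1]) := by
    ext i j
    fin_cases i <;> fin_cases j <;> simp [mass, toC, Matrix.vecMulVec_apply, sq]
  rw [this]
  exact Matrix.posSemidef_vecMulVec_self_star _

theorem evalAt_linear (A B : Matrix (Fin 2) (Fin 2) ℂ) (t : ℝ) :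
    evalAt (C A + X * C B) t = A + (t : ℂ) • B := by
  rw [evalAt_add, evalAt_mul, evalAt_C, evalAt_C, ← pow_one X, evalAt_X_pow, pow_one,
    Matrix.scalar_apply, ← Matrix.smul_eq_diagonal_mul]

theorem evalAt_quadratic (A B E : Matrix (Fin 2) (Fin 2) ℂ) (t : ℝ) :
    evalAt (C A + X * C B + X ^ 2 * C E) t = A + (t : ℂ) • B + (t : ℂ) ^ 2 • E := by
  rw [evalAt_add, evalAt_linear, evalAt_mul, evalAt_C, evalAt_X_pow,
    Matrix.scalar_apply, ← Matrix.smul_eq_diagonal_mul]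

theorem evalAt_laguerreF₂_mul_mass (ha : a ≠ 0) :
    evalAt (laguerreF₂ ε a α t₀) t₀ * mass ε a α t₀ = 0 := by
  have hrel : (_ : ℂ) = _ := congrArg Complex.ofReal (phi_relation ε ha α t₀)
  have hα : (_ : ℂ) = _ := congrArg Complex.ofReal (eq_mul_sub_sub α t₀ ha)
  rw [laguerreF₂_eq ε α t₀ ha, evalAt_quadratic, mass]
  -- Only `hrel` and `hα` matter from here; forgetting the definitions removes the square root and
  -- the division.
  generalize phi ε a α t₀ = p at *
  generalize (t₀ + α + 1) / a = r at *
  push_cast at hrel hα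
  ext i j
  fin_cases i <;> fin_cases j <;>
    simp [toC, Matrix.mul_apply, Fin.sum_univ_two, quadCoeff₀, quadCoeff₁, quadCoeff₂]
  · linear_combination t₀ * p * hrel + t₀ ^ 2 * (1 + a ^ 2) * p * hα
  · linear_combination t₀ * hrel + t₀ ^ 2 * (1 + a ^ 2) * hα
  · ring
  · ring

theorem evalAt_laguerreF₁_mul_mass (ha : a ≠ 0) :
    evalAt (laguerreF₁ ε a α t₀) t₀ * mass ε a α t₀ = 0 := by
  have hrel : (_ : ℂ) = _ := congrArg Complex.ofReal (phi_relation ε ha α t₀)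
  have hα : (_ : ℂ) = _ := congrArg Complex.ofReal (eq_mul_sub_sub α t₀ ha)
  rw [laguerreF₁_eq, evalAt_linear, mass]
  generalize phi ε a α t₀ = p at *
  generalize (t₀ + α + 1) / a = r at *
  push_cast at hrel hα
  ext i j
  fin_cases i <;> fin_cases j <;>
    simp [toC, Matrix.mul_apply, Fin.sum_univ_two, linCoeff₀, linCoeff₁]
  · rw [hα]
    linear_combination (a * r - 2 * t₀ + 2) * p * hrel
  · rw [hα]
    linear_combination (a * r - 2 * t₀ + 2) * hrel
  · ring
  · ring

theorem laguerreF₀_mul_mass (ha : a ≠ 0) :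
    laguerreF₀ ε a α t₀ * mass ε a α t₀ = mass ε a α t₀ * (laguerreF₀ ε a α t₀)ᴴ := by
  have hrel : (_ : ℂ) = _ := congrArg Complex.ofReal (phi_relation ε ha α t₀)
  have hα : (_ : ℂ) = _ := congrArg Complex.ofReal (eq_mul_sub_sub α t₀ ha)
  have hf : (_ : ℂ) = _ := congrArg Complex.ofReal (offDiag_mul_eq (a := a) α)
  have hd : (_ : ℂ) = _ := congrArg Complex.ofReal (two_mul_laguerreF₀Diag ε α t₀ ha)
  rw [laguerreF₀_eq, mass]
  generalize phi ε a α t₀ = p at *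
  generalize (t₀ + α + 1) / a = r at *
  generalize (1 + α) / (1 + a ^ 2) = f at *
  generalize laguerreF₀Diag ε a α t₀ = d at *
  push_cast at hrel hα hf hd
  ext i j
  fin_cases i <;> fin_cases j <;>
    simp [toC, Matrix.mul_apply, Fin.sum_univ_two, constCoeff]
  · ring
  · rw [hα] at hf hd ⊢
    linear_combination -(1 + f) * hrel + ((t₀ - 1) * (a * r - t₀ - 1) - r * p) * hf + p * hd
  · rw [hα] at hf hd ⊢
    linear_combination (1 + f) * hrel - ((t₀ - 1) * (a * r - t₀ - 1) - r * p) * hf - p * hd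
  · ring

theorem isHermitian_moment_laguerreWeight (a : ℝ) {α : ℝ} (hα : -1 < α) (k : ℕ) :
    (moment (laguerreWeight a α) k).IsHermitian :=
  isHermitian_moment (fun _ hs => (posSemidef_setValue_laguerreWeight a hα hs).1)
    (hasMoments_laguerreWeight a hα) k

theorem isSymmetric_iff {U : MatrixMeasure (Fin 2)} (ha : a ≠ 0) (hU : HasMoments U)
    (hH : ∀ k, (moment U k).IsHermitian) :
    (laguerreOperator ε a α t₀).IsSymmetric U ↔
      MomentEquations (toC (quadCoeff₀ a t₀))
        (toC (quadCoeff₁ a ((t₀ + α + 1) / a) (phi ε a α t₀))) (toC (quadCoeff₂ a α))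
        (toC (linCoeff₀ a ((t₀ + α + 1) / a) t₀ α (phi ε a α t₀)))
        (toC (linCoeff₁ a ((t₀ + α + 1) / a) t₀ α (phi ε a α t₀)))
        (toC (constCoeff a t₀ α (phi ε a α t₀) (laguerreF₀Diag ε a α t₀)
          ((1 + α) / (1 + a ^ 2)))) (moment U) :=
  isSymmetric_iff_momentEquations (laguerreF₂_eq ε α t₀ ha) (laguerreF₁_eq ε α t₀) rfl hU hH

theorem isSymmetric_laguerreWeight (ha : a ≠ 0) (hα : -1 < α) :
    (laguerreOperator ε a α t₀).IsSymmetric (laguerreWeight a α) := by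
  rw [isSymmetric_iff ε α t₀ ha (hasMoments_laguerreWeight a hα)
    (isHermitian_moment_laguerreWeight a hα)]
  have : moment (laguerreWeight a α) = laguerreMoment a (fun k => Real.Gamma (α + 1 + k)) :=
    funext (moment_laguerreWeight a hα)
  rw [this]
  refine momentEquations_laguerreMoment (eq_mul_sub_sub α t₀ ha) (offDiag_mul_eq α)
    (two_mul_laguerreF₀Diag ε α t₀ ha) fun k => ?_
  have h : α + 1 + k ≠ 0 := by have : (0 : ℝ) ≤ k := k.cast_nonneg; linarith
  rw [Nat.cast_succ, ← add_assoc, Real.Gamma_add_one h]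

theorem isSymmetric_combination_laguerreWeight_pointMass (ha : a ≠ 0) (hα : -1 < α) (γ ζ : ℝ) :
    (laguerreOperator ε a α t₀).IsSymmetric
      (γ • laguerreWeight a α + ζ • pointMass t₀ (mass ε a α t₀)) :=
  isSymmetric_combination (hasMoments_laguerreWeight a hα) (hasMoments_pointMass _ _)
    (isSymmetric_laguerreWeight ε α t₀ ha hα)
    (isSymmetric_pointMass (posSemidef_mass ε α t₀).1 (evalAt_laguerreF₂_mul_mass ε α t₀ ha)
      (evalAt_laguerreF₁_mul_mass ε α t₀ ha)
      (by simpa only [laguerreOperator, evalAt_C] using laguerreF₀_mul_mass ε α t₀ ha)) γ ζ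

theorem exists_eq_combination_of_mem_Upsilon (ha : a ≠ 0) (hα : -1 < α)
    {U : MatrixMeasure (Fin 2)} (hU : U ∈ Upsilon (laguerreOperator ε a α t₀)) :
    ∃ γ ζ : ℝ, 0 < γ ∧ 0 ≤ ζ ∧
      U = γ • laguerreWeight a α + ζ • pointMass t₀ (mass ε a α t₀) := by
  obtain ⟨hw, hs⟩ := hU
  have hm : HasMoments U := hw.moments
  have hH := isHermitian_moment (fun s hs => (hw.posSemidef s hs).1) hm
  rw [isSymmetric_iff ε α t₀ ha hm hH] at hs
  obtain ⟨γ, ζ, h⟩ := exists_moment_eq hα (eq_mul_sub_sub α t₀ ha) rfl (phi_relation ε ha α t₀)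
    (offDiag_mul_eq α) (two_mul_laguerreF₀Diag ε α t₀ ha) hH hs
  refine ⟨γ, ζ, eq_combination_of_moment_eq a hα t₀ (posSemidef_mass ε α t₀) (by simp [mass, toC])
    hw fun k => ?_⟩
  rw [h, moment_laguerreWeight a hα, moment_pointMass]
  rfl

end Operator

end MatrixOrthogonality

end

open MatrixOrthogonality in
theorem mainTheorem4 (a α t₀ : ℝ) (ha : a ≠ 0) (hα : -1 < α) (ε : ℤˣ) :
    (mass ε a α t₀).PosSemidef ∧
    (evalAt (laguerreF₂ ε a α t₀) t₀ * mass ε a α t₀ = 0 ∧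
      evalAt (laguerreF₁ ε a α t₀) t₀ * mass ε a α t₀ = 0 ∧
      laguerreF₀ ε a α t₀ * mass ε a α t₀ = mass ε a α t₀ * (laguerreF₀ ε a α t₀)ᴴ) ∧
    (∀ γ ζ : ℝ, 0 < γ → 0 ≤ ζ →
      (laguerreOperator ε a α t₀).IsSymmetric
        (γ • laguerreWeight a α + ζ • pointMass t₀ (mass ε a α t₀))) ∧
    Upsilon (laguerreOperator ε a α t₀) =
      {U : MatrixMeasure (Fin 2) | ∃ γ ζ : ℝ, 0 < γ ∧ 0 ≤ ζ ∧
        U = γ • laguerreWeight a α + ζ • pointMass t₀ (mass ε a α t₀)} := by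
  refine ⟨posSemidef_mass ε α t₀, ⟨evalAt_laguerreF₂_mul_mass ε α t₀ ha,
    evalAt_laguerreF₁_mul_mass ε α t₀ ha, laguerreF₀_mul_mass ε α t₀ ha⟩,
    fun γ ζ _ _ => isSymmetric_combination_laguerreWeight_pointMass ε α t₀ ha hα γ ζ,
    Set.Subset.antisymm (fun U hU => exists_eq_combination_of_mem_Upsilon ε α t₀ ha hα hU) ?_⟩
  rintro U ⟨γ, ζ, hγ, hζ, rfl⟩
  exact ⟨isWeightMatrix_combination a hα t₀ (posSemidef_mass ε α t₀) hγ hζ,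
    isSymmetric_combination_laguerreWeight_pointMass ε α t₀ ha hα γ ζ⟩
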